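/- **Setting.** Let $n\ge 1$ and $0<s<1$. Let $m:[0,\infty)\to[0,\infty)$ be nondecreasing and right continuous, with $m(t)=0$ if and only if $t=0$ and $m(t)\to\infty$ as $t\to\infty$; extend $m$ to $\mathbb R$ by oddness. Let $M(t)=\int_0^{|t|}m(r)\,dr$ be the corresponding Young function and $\bar M(t)=\sup_{\tau\ge 0}\{\tau|t|-M(\tau)\}$ its complementary function; no $\Delta_2$-condition is assumed on $M$ or $\bar M$. On $\mathbb R^{2n}=\mathbb R^n\times\mathbb R^n$ put $d\nu_n=|x-y|^{-n}\,dx\,dy$, and write $D^su(x,y)=\dfrac{u(x)-u(y)}{|x-y|^s}$ for $u:\mathbb R^n\to\mathbb R$. For $A\in\{M,\bar M\}$ and a measure $\mu$, $L_A(\mu)$ is the Orlicz space of measurable $u$ with $\int A(u/k)\,d\mu<\infty$ for some $k>0$, with the Luxemburg norm $\|u\|_{A,\mu}=\inf\{k>0:\int A(u/k)\,d\mu\le 1\}$, and $E_A(\mu)$ is the closure in $L_A(\mu)$ of the bounded measurable functions vanishing outside a bounded set of finite $\mu$-measure. We write $L_A,E_A$ for $\mu=dx$ on $\mathbb R^n$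 and $L_A(\nu_n),E_A(\nu_n)$ for $\mu=\nu_n$ on $\mathbb R^{2n}$. Let $W^sL_M=\{u\in L_M: D^su\in L_M(\nu_n)\}$ and $W^sE_M=\{u\in E_M: D^su\in E_M(\nu_n)\}$, with the norm $\|u\|_M+\|D^su\|_{M,\nu_n}$; a function $u$ is identified with the pair $(u,D^su)$. Let $\Omega\subset\mathbb R^n$ be a bounded open set with the *segment property*: there are a locally finite covering of $\partial\Omega$ by balls $B_r(x_j)$ of a common radius $r>0$ with $x_j\in\partial\Omega$, unit vectors $e_j$, and $t^*\in(0,1)$ such that $x+te_j\in\Omega$ whenever $x\in\bar\Omega\cap B_r(x_j)$ and $0<t<t^*$. Let $\mathcal D(\Omega)$ be the space of smooth functions with compact support in $\Omega$. * $W^s_0L_M(\Omega)$ is the closure of $\mathcal D(\Omega)$ in $W^sL_M$ for the topology $\sigma(L_M\times L_M(\nu_n),E_{\bar M}\times E_{\bar M}(\nu_n))$, and $W^s_0E_M(\Omega)$ is the norm closure of $\mathcal D(\Omega)$ in $W^sE_M$. * $W^{-s}L_{\bar M}(\Omega)$ (respectively $W^{-s}E_{\bar M}(\Omega)$) is the space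 of distributions on $\Omega$ of the form $T=g+\mathrm{div}^sG$, that is, $\langle T,\varphi\rangle=\int_{\mathbb R^n} g\varphi\,dx+\iint_{\mathbb R^{2n}} G\,D^s\varphi\,d\nu_n$ for $\varphi\in\mathcal D(\Omega)$, with $g\in L_{\bar M}$, $G\in L_{\bar M}(\nu_n)$ (respectively $g\in E_{\bar M}$, $G\in E_{\bar M}(\nu_n)$). For $v\in W^s_0L_M(\Omega)$ one sets $\langle T,v\rangle=\int gv\,dx+\iint G\,D^sv\,d\nu_n$; by the segment property this does not depend on the representation of $T$. * $\mathrm{Dom}((-\Delta_m)^s)=\{u\in W^s_0L_M(\Omega): m(D^su)\in L_{\bar M}(\nu_n)\}$, and for $u$ in this set $(-\Delta_m)^su\in W^{-s}L_{\bar M}(\Omega)$ is the distribution $$\langle(-\Delta_m)^su,\varphi\rangle=\lim_{\varepsilon\downarrow0}\int_{\mathbb R^n}\Big(2\int_{|x-y|\ge\varepsilon}m(D^su(x,y))\,\frac{dy}{|x-y|^{n+s}}\Big)\varphi(x)\,dx,\qquad \varphi\in\mathcal D(\Omega).$$ **Theorem.** Let $(u_i)_{i\in\mathbb N}\subset\mathrm{Dom}((-\Delta_m)^s)$,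 $u\in W^s_0L_M(\Omega)$ and $f\in W^{-s}L_{\bar M}(\Omega)$ be such that 1. $u_i\to u$ for $\sigma(W^s_0L_M(\Omega),W^{-s}E_{\bar M}(\Omega))$, i.e. $\langle S,u_i\rangle\to\langle S,u\rangle$ for all $S\in W^{-s}E_{\bar M}(\Omega)$; 2. $(-\Delta_m)^su_i\to f$ for $\sigma(W^{-s}L_{\bar M}(\Omega),W^s_0E_M(\Omega))$, i.e. $\langle(-\Delta_m)^su_i,v\rangle\to\langle f,v\rangle$ for all $v\in W^s_0E_M(\Omega)$; 3. $\limsup_{i\to\infty}\langle(-\Delta_m)^su_i,u_i\rangle\le\langle f,u\rangle$. Then $u\in\mathrm{Dom}((-\Delta_m)^s)$, $(-\Delta_m)^su=f$, and $\langle(-\Delta_m)^su_i,u_i\rangle\to\langle f,u\rangle$ as $i\to\infty$. -/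

import Mathlib

open MeasureTheory Filter Topology Set TopologicalSpace
open scoped Distributions ENNReal

noncomputable section

/-! ## Young functions -/

/-- `m` is the (oddly extended) density of a Young function: on `[0, ∞)` it is nondecreasing,
right continuous, vanishes exactly at `0` and tends to infinity; on the whole line it is odd. -/
structure IsYoungDensity (m : ℝ → ℝ) : Prop where
  odd : ∀ t, m (-t) = -m t
  mono : MonotoneOn m (Ici 0)
  right_cont : ∀ t, 0 ≤ t → ContinuousWithinAt m (Ici t) t
  eq_zero_iff : ∀ t, 0 ≤ t → (m t = 0 ↔ t = 0)
  tendsto_atTop : Tendsto m atTop atTop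

/-- The Young function `M(t) = ∫₀^{|t|} m(r) dr` with density `m`. -/
def youngFn (m : ℝ → ℝ) (t : ℝ) : ℝ := ∫ r in (0 : ℝ)..|t|, m r

/-- The complementary function `A̅(t) = sup {τ|t| - A(τ) : τ ≥ 0}`. -/
def complementaryFn (A : ℝ → ℝ) (t : ℝ) : ℝ := ⨆ τ : Ici (0 : ℝ), ((τ : ℝ) * |t| - A τ)

/-! ## Orlicz spaces -/

section Orlicz

variable {X : Type*} [MeasurableSpace X]

/-- `∫ A(u) dμ`, as an element of `[0, ∞]`. -/
def modular (A : ℝ → ℝ) (μ : Measure X) (u : X → ℝ) : ℝ≥0∞ :=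
  ∫⁻ x, ENNReal.ofReal (A (u x)) ∂μ

/-- The Orlicz space `L_A(μ)`: measurable functions with `∫ A(u/k) dμ < ∞` for some `k > 0`. -/
def MemOrlicz (A : ℝ → ℝ) (μ : Measure X) (u : X → ℝ) : Prop :=
  AEMeasurable u μ ∧ ∃ k : ℝ, 0 < k ∧ modular A μ (fun x => u x / k) < ∞

/-- The Luxemburg norm `inf {k > 0 : ∫ A(u/k) dμ ≤ 1}`. -/
def luxNorm (A : ℝ → ℝ) (μ : Measure X) (u : X → ℝ) : ℝ :=
  sInf {k : ℝ | 0 < k ∧ modular A μ (fun x => u x / k) ≤ 1}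

/-- The space `E_A(μ)`: the closure in `L_A(μ)`, for the Luxemburg norm, of the bounded measurable
functions that vanish outside a bounded set of finite measure. -/
def MemOrliczE [Bornology X] (A : ℝ → ℝ) (μ : Measure X) (u : X → ℝ) : Prop :=
  MemOrlicz A μ u ∧ ∀ ε : ℝ, 0 < ε → ∃ g : X → ℝ,
    Measurable g ∧ (∃ C : ℝ, ∀ x, |g x| ≤ C) ∧
    Bornology.IsBounded (Function.support g) ∧ μ (Function.support g) < ∞ ∧
    luxNorm A μ (fun x => u x - g x) < ε

end Orlicz

/-! ## Fractional Orlicz–Sobolev spaces -/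

/-- The Euclidean space `ℝⁿ`. -/
abbrev Rn (n : ℕ) : Type := EuclideanSpace ℝ (Fin n)

variable {n : ℕ}

/-- The measure `dν_n = dx dy / |x - y|ⁿ` on `ℝⁿ × ℝⁿ`. -/
def nuMeasure (n : ℕ) : Measure (Rn n × Rn n) :=
  (volume : Measure (Rn n × Rn n)).withDensity
    (fun p => ENNReal.ofReal (1 / ‖p.1 - p.2‖ ^ n))

/-- The Hölder quotient `Dˢu(x, y) = (u(x) - u(y)) / |x - y|ˢ`. -/
def holderQuot (s : ℝ) (u : Rn n → ℝ) (p : Rn n × Rn n) : ℝ :=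
  (u p.1 - u p.2) / ‖p.1 - p.2‖ ^ s

/-- The space `WˢL_A`. -/
def MemWL (A : ℝ → ℝ) (s : ℝ) (u : Rn n → ℝ) : Prop :=
  MemOrlicz A volume u ∧ MemOrlicz A (nuMeasure n) (holderQuot s u)

/-- The space `WˢE_A`. -/
def MemWE (A : ℝ → ℝ) (s : ℝ) (u : Rn n → ℝ) : Prop :=
  MemOrliczE A volume u ∧ MemOrliczE A (nuMeasure n) (holderQuot s u)

/-- The pairing `∫ g v dx + ∬ G Dˢv dν_n` of `(g, G)` with `(v, Dˢv)`. -/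
def pairing (s : ℝ) (g : Rn n → ℝ) (G : Rn n × Rn n → ℝ) (v : Rn n → ℝ) : ℝ :=
  (∫ x, g x * v x) + ∫ p, G p * holderQuot s v p ∂(nuMeasure n)

/-- The family of all pairings of `(u, Dˢu)` with the elements `(g, G)` of `E_B × E_B(ν_n)`.
The topology `σ(L_A × L_A(ν_n), E_B × E_B(ν_n))` on `WˢL_A` is the one induced by this map from the
topology of pointwise convergence. -/
def weakCoord (B : ℝ → ℝ) (s : ℝ) (u : Rn n → ℝ) :
    {q : (Rn n → ℝ) × (Rn n × Rn n → ℝ) //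
      MemOrliczE B volume q.1 ∧ MemOrliczE B (nuMeasure n) q.2} → ℝ :=
  fun q => pairing s q.1.1 q.1.2 u

/-- The space `W₀ˢL_M(Ω)`, `M` being the Young function with density `m`: the closure of `𝓓(Ω)` in
`WˢL_M` for the topology `σ(L_M × L_M(ν_n), E_M̅ × E_M̅(ν_n))`. -/
def MemW0L (m : ℝ → ℝ) (s : ℝ) (Ω : Opens (Rn n)) (u : Rn n → ℝ) : Prop :=
  MemWL (youngFn m) s u ∧
    weakCoord (complementaryFn (youngFn m)) s u ∈
      closure (range fun φ : 𝓓(Ω, ℝ) => weakCoord (complementaryFn (youngFn m)) s φ)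

/-- The space `W₀ˢE_M(Ω)`: the closure of `𝓓(Ω)` in `WˢE_M` for the norm
`‖u‖_M + ‖Dˢu‖_{M, ν_n}`. -/
def MemW0E (m : ℝ → ℝ) (s : ℝ) (Ω : Opens (Rn n)) (u : Rn n → ℝ) : Prop :=
  MemWE (youngFn m) s u ∧ ∀ ε : ℝ, 0 < ε → ∃ φ : 𝓓(Ω, ℝ),
    luxNorm (youngFn m) volume (fun x => u x - φ x) +
      luxNorm (youngFn m) (nuMeasure n) (holderQuot s (fun x => u x - φ x)) < ε

/-! ## Dual spaces

A distribution `g + divˢG` acts on a test function `φ` by `∫ g φ dx + ∬ G Dˢφ dν_n`. A functional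
of this form on `𝓓(Ω)` is automatically linear and continuous, so that the spaces below, given as
sets of functions `𝓓(Ω) → ℝ`, consist of distributions. -/

/-- The space `W^{-s}L_M̅(Ω)`. -/
def MemNegL (m : ℝ → ℝ) (s : ℝ) (Ω : Opens (Rn n)) (T : 𝓓(Ω, ℝ) → ℝ) : Prop :=
  ∃ (g : Rn n → ℝ) (G : Rn n × Rn n → ℝ),
    MemOrlicz (complementaryFn (youngFn m)) volume g ∧
    MemOrlicz (complementaryFn (youngFn m)) (nuMeasure n) G ∧
    ∀ φ : 𝓓(Ω, ℝ), T φ = pairing s g G φ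

/-- The space `W^{-s}E_M̅(Ω)`. -/
def MemNegE (m : ℝ → ℝ) (s : ℝ) (Ω : Opens (Rn n)) (T : 𝓓(Ω, ℝ) → ℝ) : Prop :=
  ∃ (g : Rn n → ℝ) (G : Rn n × Rn n → ℝ),
    MemOrliczE (complementaryFn (youngFn m)) volume g ∧
    MemOrliczE (complementaryFn (youngFn m)) (nuMeasure n) G ∧
    ∀ φ : 𝓓(Ω, ℝ), T φ = pairing s g G φ

open Classical in
/-- The duality `⟨T, v⟩ = ∫ g v dx + ∬ G Dˢv dν_n` of `T = g + divˢG ∈ W^{-s}L_M̅(Ω)` and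
`v ∈ W₀ˢL_M(Ω)`. If `Ω` has the segment property, then the value does not depend on the chosen
representation `(g, G)` of `T`. -/
def dualPair (m : ℝ → ℝ) (s : ℝ) (Ω : Opens (Rn n)) (T : 𝓓(Ω, ℝ) → ℝ) (v : Rn n → ℝ) : ℝ :=
  if h : MemNegL m s Ω T then pairing s h.choose h.choose_spec.choose v else 0

/-! ## The fractional `m`-Laplacian -/

/-- `Dom((-Δ_m)ˢ)`: those `u ∈ W₀ˢL_M(Ω)` with `m(Dˢu) ∈ L_M̅(ν_n)`. -/
def MemDom (m : ℝ → ℝ) (s : ℝ) (Ω : Opens (Rn n)) (u : Rn n → ℝ) : Prop :=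
  MemW0L m s Ω u ∧
    MemOrlicz (complementaryFn (youngFn m)) (nuMeasure n) (fun p => m (holderQuot s u p))

/-- `(-Δ_m)ˢ_ε u(x) = 2 ∫_{|x - y| ≥ ε} m(Dˢu(x, y)) dy / |x - y|^{n + s}`. -/
def fracLapTrunc (m : ℝ → ℝ) (s ε : ℝ) (u : Rn n → ℝ) (x : Rn n) : ℝ :=
  2 * ∫ y in {y | ε ≤ ‖x - y‖}, m (holderQuot s u (x, y)) / ‖x - y‖ ^ ((n : ℝ) + s)

/-- The fractional `m`-Laplacian of `u` as a distribution on `Ω`: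
`⟨(-Δ_m)ˢu, φ⟩ = lim_{ε ↓ 0} ∫ (-Δ_m)ˢ_ε u φ dx`. -/
def fracLap (m : ℝ → ℝ) (s : ℝ) (Ω : Opens (Rn n)) (u : Rn n → ℝ) (φ : 𝓓(Ω, ℝ)) : ℝ :=
  limUnder (𝓝[>] (0 : ℝ)) (fun ε => ∫ x, fracLapTrunc m s ε u x * φ x)

/-! ## The segment property -/

/-- The segment property: `∂Ω` has a locally finite covering by balls `B_r(c_j)` centred on `∂Ω`,
with unit vectors `e_j` and a number `t₀ ∈ (0, 1)`, such that `x + t e_j ∈ Ω` whenever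
`x ∈ Ω̅ ∩ B_r(c_j)` and `0 < t < t₀`. -/
def SegmentProperty (Ω : Set (Rn n)) : Prop :=
  ∃ (ι : Type) (c e : ι → Rn n) (r t₀ : ℝ),
    0 < r ∧ 0 < t₀ ∧ t₀ < 1 ∧
    (∀ j, c j ∈ frontier Ω) ∧ (∀ j, ‖e j‖ = 1) ∧
    LocallyFinite (fun j => Metric.ball (c j) r) ∧
    frontier Ω ⊆ ⋃ j, Metric.ball (c j) r ∧
    ∀ j, ∀ x ∈ closure Ω ∩ Metric.ball (c j) r, ∀ t : ℝ, 0 < t → t < t₀ → x + t • e j ∈ Ω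

end

/-! Since `m` is odd and `ν_n` is invariant under swapping the variables, symmetrizing the truncated
integrals gives the weak form `⟨(-Δ_m)ˢu, φ⟩ = ∬ m(Dˢu) Dˢφ dν_n` (`integral_fracLapTrunc`,
`fracLap_eq_pairing`). To test with elements of `W₀ˢL_M(Ω)`, a pairing that vanishes on `𝓓(Ω)` must
vanish on the whole space (`pairing_eq_zero`): elements of the space vanish a.e. off `Ω`, cutoffs
split them into pieces that the segment property translates into `Ω`, and mollification turns pieces
with compact support in `Ω` into test functions. Norm continuity of translations may fail without
Δ₂, but weak continuity suffices. It follows from Young's inequality and dominated convergence,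
because the dominating functions keep their integral under translation
(`tendsto_integral_mul_comp`). The duality is then independent of the representation, and
`⟨(-Δ_m)ˢu_i, u_i⟩` is the energy `∬ m(Dˢu_i) Dˢu_i dν_n`.

No monotonicity trick is needed, because there is convergence almost everywhere. The third
hypothesis bounds the energies, and `M(t) ≤ m(t) t` then bounds the modulars of `Dˢu_i`. A function
differs from its means over balls of radius `δ` by `O(δˢ)` in `L¹` on sets of finite measure
(`lintegral_sub_ballMean_le`), and weak convergence makes these means converge. Hence a subsequence
of `u_i` converges a.e. and `Dˢu_i → Dˢu` a.e. The density `m` may jump, but every nonzero level set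
of a Hölder quotient is null (`ae_holderQuot_ne`), so also `m(Dˢu_i) → m(Dˢu)` a.e.

Fatou's lemma finishes the proof in three ways. Applied to the energies, it gives finite energy for
`u`, and `M̅(m(t)) ≤ m(t) t` puts `u` in the domain. Applied to `m(Dˢu_i) P + ε (m(Dˢu_i) Dˢu_i +
M(P/ε)) ≥ 0` with `P = ±Dˢφ`, it identifies `(-Δ_m)ˢu` with `f` (`integral_mul_le_of_ae_tendsto`).
Finally `⟨f, u⟩` is the energy of `u`, so lower semicontinuity along subsequences supplies the
missing lower bound. -/

noncomputable section

variable {n : ℕ}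

/-! ## Young functions -/

/-- The properties shared by a Young function and its complementary function. -/
structure IsYoungLike (A : ℝ → ℝ) : Prop where
  zero : A 0 = 0
  mono : ∀ a b, |a| ≤ |b| → A a ≤ A b
  convex : ConvexOn ℝ univ A

namespace IsYoungLike

variable {A : ℝ → ℝ}

theorem nonneg (hA : IsYoungLike A) (t : ℝ) : 0 ≤ A t := by
  rw [← hA.zero]; exact hA.mono _ _ (by simp)

theorem abs_eq (hA : IsYoungLike A) (t : ℝ) : A |t| = A t :=
  le_antisymm (hA.mono _ _ (by simp)) (hA.mono _ _ (by simp))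

theorem continuous (hA : IsYoungLike A) : Continuous A := by
  have := hA.convex.continuousOn isOpen_univ
  exact continuousOn_univ.1 this

theorem measurable (hA : IsYoungLike A) : Measurable A := hA.continuous.measurable

theorem mul_le (hA : IsYoungLike A) {c : ℝ} (hc0 : 0 ≤ c) (hc1 : c ≤ 1) (t : ℝ) :
    A (c * t) ≤ c * A t := by
  have := hA.convex.2 (mem_univ t) (mem_univ 0) hc0 (sub_nonneg.2 hc1) (by ring)
  simpa [hA.zero] using this

theorem div_le (hA : IsYoungLike A) {k : ℝ} (hk : 1 ≤ k) (t : ℝ) : A (t / k) ≤ A t / k := by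
  have := hA.mul_le (c := k⁻¹) (by positivity) (inv_le_one_of_one_le₀ hk) t
  simpa [div_eq_inv_mul] using this

theorem half_add_le (hA : IsYoungLike A) (a b : ℝ) : A ((a + b) / 2) ≤ (A a + A b) / 2 := by
  have := hA.convex.2 (mem_univ a) (mem_univ b) (show (0 : ℝ) ≤ 1 / 2 by norm_num)
    (show (0 : ℝ) ≤ 1 / 2 by norm_num) (by norm_num)
  simp only [smul_eq_mul] at this
  calc A ((a + b) / 2) = A (1 / 2 * a + 1 / 2 * b) := by congr 1; ring
    _ ≤ _ := this
    _ = _ := by ring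

/-- A Young function that is positive at `1` dominates `|t|` up to constants. -/
theorem abs_le (hA : IsYoungLike A) (h1 : 0 < A 1) (t : ℝ) : |t| ≤ 1 + A t / A 1 := by
  rcases le_total |t| 1 with h | h
  · have := div_nonneg (hA.nonneg t) h1.le
    linarith
  · have h2 := hA.div_le h |t|
    rw [div_self (by positivity), hA.abs_eq, le_div_iff₀ (by positivity)] at h2
    have : |t| ≤ A t / A 1 := by rw [le_div_iff₀ h1]; linarith
    linarith

end IsYoungLike

namespace IsYoungDensity

variable {m : ℝ → ℝ}

theorem map_zero (hm : IsYoungDensity m) : m 0 = 0 := (hm.eq_zero_iff 0 le_rfl).2 rfl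

theorem nonneg (hm : IsYoungDensity m) {t : ℝ} (ht : 0 ≤ t) : 0 ≤ m t := by
  rw [← hm.map_zero]; exact hm.mono (mem_Ici.2 le_rfl) (mem_Ici.2 ht) ht

theorem monotone (hm : IsYoungDensity m) : Monotone m := by
  intro a b hab
  rcases le_total 0 a with ha | ha
  · exact hm.mono ha (ha.trans hab) hab
  · have ha' : m a = - m (-a) := by rw [hm.odd]; ring
    rcases le_total 0 b with hb | hb
    · have := hm.nonneg hb
      have := hm.nonneg (neg_nonneg.2 ha)
      linarith
    · have hb' : m b = - m (-b) := by rw [hm.odd]; ring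
      have := hm.mono (mem_Ici.2 (neg_nonneg.2 hb)) (mem_Ici.2 (neg_nonneg.2 ha)) (neg_le_neg hab)
      linarith

theorem measurable (hm : IsYoungDensity m) : Measurable m := hm.monotone.measurable

theorem intervalIntegrable (hm : IsYoungDensity m) (a b : ℝ) :
    IntervalIntegrable m volume a b := hm.monotone.intervalIntegrable

theorem mul_self_nonneg (hm : IsYoungDensity m) (t : ℝ) : 0 ≤ m t * t := by
  rcases le_total 0 t with h | h
  · exact mul_nonneg (hm.nonneg h) h
  · have : m t ≤ m 0 := hm.monotone h
    rw [hm.map_zero] at this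
    exact mul_nonneg_of_nonpos_of_nonpos this h

theorem abs_mul_abs (hm : IsYoungDensity m) (t : ℝ) : m |t| * |t| = m t * t := by
  rcases abs_cases t with ⟨h, _⟩ | ⟨h, _⟩
  · rw [h]
  · rw [h, hm.odd]; ring

theorem abs_apply (hm : IsYoungDensity m) (t : ℝ) : |m t| = m |t| := by
  rcases le_total 0 t with h | h
  · rw [abs_of_nonneg h, abs_of_nonneg (hm.nonneg h)]
  · rw [abs_of_nonpos h, hm.odd, abs_of_nonpos]
    have := hm.monotone h
    rwa [hm.map_zero] at this

/-- The subgradient inequality `M(b) - M(a) ≥ m(a) (b - a)` for `a, b ≥ 0`. -/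
theorem subgradient (hm : IsYoungDensity m) {a b : ℝ} (ha : 0 ≤ a) (hb : 0 ≤ b) :
    m a * (b - a) ≤ youngFn m b - youngFn m a := by
  unfold youngFn
  rw [abs_of_nonneg ha, abs_of_nonneg hb, intervalIntegral.integral_interval_sub_left
    (hm.intervalIntegrable _ _) (hm.intervalIntegrable _ _)]
  rcases le_total a b with h | h
  · have := intervalIntegral.integral_mono_on h (f := fun _ => m a) (g := m) (μ := volume)
      (by simp) (hm.intervalIntegrable _ _) (fun x hx => hm.monotone hx.1)
    simp only [intervalIntegral.integral_const, smul_eq_mul] at this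
    linarith
  · have := intervalIntegral.integral_mono_on h (f := m) (g := fun _ => m a) (μ := volume)
      (hm.intervalIntegrable _ _) (by simp) (fun x hx => hm.monotone hx.2)
    simp only [intervalIntegral.integral_const, smul_eq_mul] at this
    rw [intervalIntegral.integral_symm]
    linarith

theorem youngFn_zero : youngFn m 0 = 0 := by simp [youngFn]

theorem youngFn_abs (t : ℝ) : youngFn m |t| = youngFn m t := by simp [youngFn]

theorem youngFn_mono (hm : IsYoungDensity m) {a b : ℝ} (h : |a| ≤ |b|) :
    youngFn m a ≤ youngFn m b := by
  have := hm.subgradient (abs_nonneg a) (abs_nonneg b)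
  rw [youngFn_abs, youngFn_abs] at this
  have h2 := mul_nonneg (hm.nonneg (abs_nonneg a)) (sub_nonneg.2 h)
  linarith

theorem isYoungLike (hm : IsYoungDensity m) : IsYoungLike (youngFn m) where
  zero := youngFn_zero
  mono := fun a b => hm.youngFn_mono
  convex := by
    refine ⟨convex_univ, fun x _ y _ a b ha hb hab => ?_⟩
    simp only [smul_eq_mul]
    have hz : |a * x + b * y| ≤ a * |x| + b * |y| := by
      refine (abs_add_le _ _).trans ?_
      rw [abs_mul, abs_mul, abs_of_nonneg ha, abs_of_nonneg hb]
    have hz0 : 0 ≤ a * |x| + b * |y| := by positivity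
    set z := a * |x| + b * |y| with hzdef
    have h1 : youngFn m (a * x + b * y) ≤ youngFn m z :=
      hm.youngFn_mono (hz.trans (le_abs_self _))
    have hx := hm.subgradient hz0 (abs_nonneg x)
    have hy := hm.subgradient hz0 (abs_nonneg y)
    rw [youngFn_abs] at hx hy
    have e : a * (m z * (|x| - z)) + b * (m z * (|y| - z)) = 0 := by
      have : a * (m z * (|x| - z)) + b * (m z * (|y| - z)) =
        m z * (z - (a + b) * z) := by rw [hzdef]; ring
      rw [this, hab]; ring
    have := mul_le_mul_of_nonneg_left hx ha
    have := mul_le_mul_of_nonneg_left hy hb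
    have e2 : youngFn m z = (a + b) * youngFn m z := by rw [hab, one_mul]
    linarith

theorem youngFn_le (hm : IsYoungDensity m) (t : ℝ) : youngFn m t ≤ m t * t := by
  have := hm.subgradient (abs_nonneg t) le_rfl
  rw [youngFn_abs, youngFn_zero] at this
  rw [← hm.abs_mul_abs]; linarith

theorem youngFn_pos (hm : IsYoungDensity m) {t : ℝ} (ht : 0 < t) : 0 < youngFn m t := by
  have h := hm.subgradient (a := t / 2) (b := t) (by linarith) ht.le
  have h1 : m (t / 2) ≠ 0 := fun h => by
    have := (hm.eq_zero_iff (t / 2) (by linarith)).1 h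
    linarith
  have h2 : 0 < m (t / 2) := lt_of_le_of_ne (hm.nonneg (by linarith)) h1.symm
  have h3 := hm.isYoungLike.nonneg (t / 2)
  have : 0 < m (t / 2) * (t - t / 2) := mul_pos h2 (by linarith)
  linarith

/-- Finiteness comes from `m → ∞`: if `m(a) ≥ |t|`, the tangent inequality at `a` gives `τ|t| - M(τ)
≤ τ m(a) - M(τ) ≤ a m(a)`. -/
theorem bddAbove_complementary (hm : IsYoungDensity m) (t : ℝ) :
    BddAbove (range fun τ : Ici (0 : ℝ) => (τ : ℝ) * |t| - youngFn m τ) := by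
  obtain ⟨T, hT⟩ := (hm.tendsto_atTop.eventually_ge_atTop |t|).exists_forall_of_atTop
  set a := max T 0
  have ha : |t| ≤ m a := hT a (le_max_left _ _)
  have ha0 : 0 ≤ a := le_max_right _ _
  refine ⟨a * m a, ?_⟩
  rintro _ ⟨⟨τ, hτ⟩, rfl⟩
  have hτ' : 0 ≤ τ := hτ
  have h := hm.subgradient ha0 hτ'
  have h2 := hm.isYoungLike.nonneg a
  have h3 : τ * |t| ≤ τ * m a := mul_le_mul_of_nonneg_left ha hτ'
  simp only
  nlinarith

theorem mul_abs_sub_le_complementary (hm : IsYoungDensity m) {τ : ℝ} (hτ : 0 ≤ τ) (t : ℝ) :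
    τ * |t| - youngFn m τ ≤ complementaryFn (youngFn m) t :=
  le_ciSup (hm.bddAbove_complementary t) (⟨τ, hτ⟩ : Ici (0 : ℝ))

/-- Young's inequality. -/
theorem young (hm : IsYoungDensity m) (τ t : ℝ) :
    |τ * t| ≤ complementaryFn (youngFn m) τ + youngFn m t := by
  have := hm.mul_abs_sub_le_complementary (abs_nonneg t) τ
  rw [youngFn_abs] at this
  rw [abs_mul]; linarith

theorem complementaryFn_le {m : ℝ → ℝ} {t C : ℝ}
    (h : ∀ τ, 0 ≤ τ → τ * |t| - youngFn m τ ≤ C) : complementaryFn (youngFn m) t ≤ C :=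
  ciSup_le fun τ => h τ τ.2

/-- The tangent inequality at `|t|` bounds every competitor in the supremum. Through this estimate
finite energy yields `m(Dˢu) ∈ L_M̅(ν_n)`. -/
theorem complementaryFn_map_le (hm : IsYoungDensity m) (t : ℝ) :
    complementaryFn (youngFn m) (m t) ≤ m t * t := by
  refine complementaryFn_le fun τ hτ => ?_
  have h := hm.subgradient (abs_nonneg t) hτ
  have h2 := hm.isYoungLike.nonneg |t|
  rw [hm.abs_apply, ← hm.abs_mul_abs]
  linarith

theorem isYoungLike_complementary (hm : IsYoungDensity m) :
    IsYoungLike (complementaryFn (youngFn m)) where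
  zero := by
    refine le_antisymm (complementaryFn_le fun τ _ => ?_) ?_
    · have := hm.isYoungLike.nonneg τ
      simpa
    · have := hm.mul_abs_sub_le_complementary le_rfl 0
      simpa [youngFn_zero] using this
  mono := fun a b h => complementaryFn_le fun τ hτ => by
    have := hm.mul_abs_sub_le_complementary hτ b
    have := mul_le_mul_of_nonneg_left h hτ
    linarith
  convex := by
    refine ⟨convex_univ, fun x _ y _ a b ha hb hab => complementaryFn_le fun τ hτ => ?_⟩
    simp only [smul_eq_mul]
    have hx := mul_le_mul_of_nonneg_left (hm.mul_abs_sub_le_complementary hτ x) ha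
    have hy := mul_le_mul_of_nonneg_left (hm.mul_abs_sub_le_complementary hτ y) hb
    have hz : |a * x + b * y| ≤ a * |x| + b * |y| := by
      refine (abs_add_le _ _).trans ?_
      rw [abs_mul, abs_mul, abs_of_nonneg ha, abs_of_nonneg hb]
    have h1 := mul_le_mul_of_nonneg_left hz hτ
    have e2 : youngFn m τ = (a + b) * youngFn m τ := by rw [hab, one_mul]
    linarith

end IsYoungDensity

/-! ## Orlicz spaces -/

section Orlicz

variable {X : Type*} [MeasurableSpace X] {μ : Measure X} {A : ℝ → ℝ}

theorem modular_mono (hA : IsYoungLike A) {f g : X → ℝ} (h : ∀ᵐ x ∂μ, |f x| ≤ |g x|) :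
    modular A μ f ≤ modular A μ g :=
  lintegral_mono_ae (h.mono fun _ hx => ENNReal.ofReal_le_ofReal (hA.mono _ _ hx))

theorem MemOrlicz.of_le (hA : IsYoungLike A) {f g : X → ℝ} (hg : MemOrlicz A μ g)
    (hf : AEMeasurable f μ) (h : ∀ᵐ x ∂μ, |f x| ≤ |g x|) : MemOrlicz A μ f := by
  obtain ⟨_, k, hk, hfin⟩ := hg
  refine ⟨hf, k, hk, (modular_mono hA (h.mono fun x hx => ?_)).trans_lt hfin⟩
  rw [abs_div, abs_div]; gcongr

theorem MemOrlicz.congr {f g : X → ℝ} (hg : MemOrlicz A μ g) (h : f =ᵐ[μ] g) :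
    MemOrlicz A μ f := by
  obtain ⟨hm, k, hk, hfin⟩ := hg
  refine ⟨hm.congr h.symm, k, hk, ?_⟩
  have : modular A μ (fun x => f x / k) = modular A μ (fun x => g x / k) :=
    lintegral_congr_ae (h.mono fun x hx => by simp only [hx])
  rwa [this]

theorem MemOrlicz.of_le_mul (hA : IsYoungLike A) {f g : X → ℝ} (hg : MemOrlicz A μ g)
    (hf : AEMeasurable f μ) {C : ℝ} (h : ∀ᵐ x ∂μ, |f x| ≤ C * |g x|) : MemOrlicz A μ f := by
  obtain ⟨_, k, hk, hfin⟩ := hg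
  have hC : 0 < max C 1 := lt_max_of_lt_right one_pos
  refine ⟨hf, k * max C 1, by positivity, (modular_mono hA (h.mono fun x hx => ?_)).trans_lt hfin⟩
  rw [abs_div, abs_div, abs_of_pos hk, abs_of_pos (show 0 < k * max C 1 by positivity),
    mul_comm k, ← div_div]
  gcongr
  rw [div_le_iff₀ hC, mul_comm]
  exact hx.trans (by gcongr; exact le_max_left _ _)

theorem MemOrlicz.const_mul (hA : IsYoungLike A) {f : X → ℝ} (hf : MemOrlicz A μ f) (c : ℝ) :
    MemOrlicz A μ (fun x => c * f x) :=
  hf.of_le_mul hA (hf.1.const_mul c) (C := |c|) (ae_of_all _ fun _ => (abs_mul _ _).le)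

theorem modular_div_lt_top_of_le (hA : IsYoungLike A) {f : X → ℝ} {k k' : ℝ} (hk : 0 < k)
    (hkk : k ≤ k') (h : modular A μ (fun x => f x / k) < ∞) :
    modular A μ (fun x => f x / k') < ∞ := by
  refine (modular_mono hA (ae_of_all _ fun x => ?_)).trans_lt h
  have : 0 < k' := hk.trans_le hkk
  rw [abs_div, abs_div, abs_of_pos hk, abs_of_pos this]
  gcongr

theorem MemOrlicz.add (hA : IsYoungLike A) {f g : X → ℝ} (hf : MemOrlicz A μ f)
    (hg : MemOrlicz A μ g) : MemOrlicz A μ (fun x => f x + g x) := by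
  obtain ⟨hfm, k, hk, hfin⟩ := hf
  obtain ⟨hgm, k', hk', hfin'⟩ := hg
  set K := max k k'
  have hK : 0 < K := hk.trans_le (le_max_left _ _)
  have h1 := modular_div_lt_top_of_le hA hk (le_max_left k k') hfin
  have h2 := modular_div_lt_top_of_le hA hk' (le_max_right k k') hfin'
  refine ⟨hfm.add hgm, 2 * K, by positivity, ?_⟩
  have hle : modular A μ (fun x => (f x + g x) / (2 * K)) ≤
      modular A μ (fun x => f x / K) + modular A μ (fun x => g x / K) := by
    unfold modular
    rw [← lintegral_add_left' (by
      exact (hA.measurable.comp_aemeasurable (hfm.div_const K)).ennreal_ofReal)]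
    refine lintegral_mono fun x => ?_
    rw [← ENNReal.ofReal_add (hA.nonneg _) (hA.nonneg _)]
    refine ENNReal.ofReal_le_ofReal ?_
    have h3 := hA.half_add_le (f x / K) (g x / K)
    have e : (f x + g x) / (2 * K) = (f x / K + g x / K) / 2 := by field_simp
    simp only [e]
    have := hA.nonneg (f x / K)
    have := hA.nonneg (g x / K)
    linarith
  exact hle.trans_lt (ENNReal.add_lt_top.2 ⟨h1, h2⟩)

theorem MemOrlicz.sub (hA : IsYoungLike A) {f g : X → ℝ} (hf : MemOrlicz A μ f)
    (hg : MemOrlicz A μ g) : MemOrlicz A μ (fun x => f x - g x) := by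
  have := hf.add hA (hg.const_mul hA (-1))
  simpa [sub_eq_add_neg] using this

theorem modular_comp {Y : Type*} [MeasurableSpace Y] {ν : Measure Y} {T : Y → X}
    (hA : IsYoungLike A) (hT : MeasurePreserving T ν μ) {f : X → ℝ} (hf : AEMeasurable f μ) :
    modular A ν (fun y => f (T y)) = modular A μ f := by
  unfold modular
  rw [← hT.map_eq, lintegral_map' _ hT.measurable.aemeasurable]
  rw [hT.map_eq]
  exact (hA.measurable.comp_aemeasurable hf).ennreal_ofReal

theorem MemOrlicz.comp {Y : Type*} [MeasurableSpace Y] {ν : Measure Y} {T : Y → X}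
    (hA : IsYoungLike A) (hT : MeasurePreserving T ν μ) {f : X → ℝ} (hf : MemOrlicz A μ f) :
    MemOrlicz A ν (fun y => f (T y)) := by
  obtain ⟨hm, k, hk, hfin⟩ := hf
  refine ⟨hm.comp_quasiMeasurePreserving hT.quasiMeasurePreserving, k, hk, ?_⟩
  rwa [modular_comp hA hT (f := fun x => f x / k) (hm.div_const k)]

theorem memOrlicz_of_modular {f : X → ℝ} (hm : AEMeasurable f μ)
    (h : modular A μ f < ∞) : MemOrlicz A μ f :=
  ⟨hm, 1, one_pos, by simpa using h⟩

theorem MemOrlicz.integrable_modular (hA : IsYoungLike A) {f : X → ℝ} (hf : MemOrlicz A μ f) :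
    ∃ k : ℝ, 0 < k ∧ Integrable (fun x => A (f x / k)) μ := by
  obtain ⟨hm, k, hk, hfin⟩ := hf
  refine ⟨k, hk, (hA.measurable.comp_aemeasurable (hm.div_const k)).aestronglyMeasurable, ?_⟩
  rw [hasFiniteIntegral_iff_ofReal (ae_of_all _ fun x => hA.nonneg _)]
  exact hfin

/-- Young's inequality for `g/k` and `f/l`, with `k` and `l` making the two modulars finite, gives
an integrable majorant. -/
theorem MemOrlicz.integrable_mul {m : ℝ → ℝ} (hm : IsYoungDensity m) {g f : X → ℝ}
    (hg : MemOrlicz (complementaryFn (youngFn m)) μ g) (hf : MemOrlicz (youngFn m) μ f) :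
    Integrable (fun x => g x * f x) μ := by
  obtain ⟨k, hk, hgi⟩ := hg.integrable_modular hm.isYoungLike_complementary
  obtain ⟨l, hl, hfi⟩ := hf.integrable_modular hm.isYoungLike
  refine ((hgi.add hfi).const_mul (k * l)).mono' (hg.1.mul hf.1).aestronglyMeasurable
    (ae_of_all _ fun x => ?_)
  have h := hm.young (g x / k) (f x / l)
  have e : g x * f x = (k * l) * (g x / k * (f x / l)) := by field_simp
  rw [Real.norm_eq_abs, e, abs_mul, abs_of_pos (mul_pos hk hl)]
  exact mul_le_mul_of_nonneg_left h (by positivity)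

theorem modular_lt_top_of_bounded (hA : IsYoungLike A) {g : X → ℝ} {C : ℝ}
    (hC : ∀ x, |g x| ≤ C) (hs : μ (Function.support g) < ∞) : modular A μ g < ∞ := by
  have hle : modular A μ g ≤
      ∫⁻ x, (toMeasurable μ (Function.support g)).indicator (fun _ => ENNReal.ofReal (A C)) x ∂μ := by
    refine lintegral_mono fun x => ?_
    by_cases hx : x ∈ Function.support g
    · rw [indicator_of_mem (subset_toMeasurable _ _ hx)]
      exact ENNReal.ofReal_le_ofReal (hA.mono _ _ ((hC x).trans (le_abs_self _)))
    · rw [Function.notMem_support.1 hx, hA.zero]; simp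
  refine hle.trans_lt ?_
  rw [lintegral_indicator (measurableSet_toMeasurable _ _), lintegral_const,
    Measure.restrict_apply_univ, measure_toMeasurable]
  exact ENNReal.mul_lt_top ENNReal.ofReal_lt_top hs

theorem luxNorm_zero (hA : IsYoungLike A) : luxNorm A μ (fun _ => (0 : ℝ)) = 0 := by
  have : {k : ℝ | 0 < k ∧ modular A μ (fun _ => (0 : ℝ) / k) ≤ 1} = Ioi 0 := by
    ext k; simp [modular, hA.zero]
  rw [luxNorm, this, csInf_Ioi]

theorem luxNorm_le {f : X → ℝ} {k : ℝ} (hk : 0 < k) (h : modular A μ (fun x => f x / k) ≤ 1) :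
    luxNorm A μ f ≤ k :=
  csInf_le ⟨0, fun _ hx => hx.1.le⟩ ⟨hk, h⟩

theorem memOrliczE_of_bounded [Bornology X] (hA : IsYoungLike A) {g : X → ℝ} (hg : Measurable g)
    {C : ℝ} (hC : ∀ x, |g x| ≤ C) (hb : Bornology.IsBounded (Function.support g))
    (hs : μ (Function.support g) < ∞) : MemOrliczE A μ g := by
  refine ⟨memOrlicz_of_modular hg.aemeasurable (modular_lt_top_of_bounded hA hC hs),
    fun ε hε => ⟨g, hg, ⟨C, hC⟩, hb, hs, ?_⟩⟩
  simpa [luxNorm_zero hA] using hε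

theorem memOrliczE_zero [Bornology X] (hA : IsYoungLike A) : MemOrliczE A μ (fun _ => (0 : ℝ)) :=
  memOrliczE_of_bounded hA measurable_const (C := 0) (by simp) (by simp) (by simp)

end Orlicz

/-! ## The measure `ν_n` -/

theorem measurable_nuDensity :
    Measurable fun p : Rn n × Rn n => ENNReal.ofReal (1 / ‖p.1 - p.2‖ ^ n) := by fun_prop

theorem lintegral_nuMeasure (f : Rn n × Rn n → ℝ≥0∞) :
    ∫⁻ p, f p ∂(nuMeasure n) = ∫⁻ p, ENNReal.ofReal (1 / ‖p.1 - p.2‖ ^ n) * f p := by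
  rw [nuMeasure, lintegral_withDensity_eq_lintegral_mul_non_measurable _ measurable_nuDensity
    (ae_of_all _ fun _ => ENNReal.ofReal_lt_top)]
  rfl

theorem nuMeasure_absolutelyContinuous : nuMeasure n ≪ (volume : Measure (Rn n × Rn n)) :=
  withDensity_absolutelyContinuous _ _

instance : SFinite (nuMeasure n) := by unfold nuMeasure; infer_instance

theorem MeasureTheory.MeasurePreserving.withDensity_of_comp_eq {α : Type*} [MeasurableSpace α]
    {μ : Measure α} {T : α → α} (hT : MeasurePreserving T μ μ) {d : α → ℝ≥0∞} (hd : Measurable d)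
    (h : ∀ x, d (T x) = d x) : MeasurePreserving T (μ.withDensity d) (μ.withDensity d) := by
  refine ⟨hT.measurable, Measure.ext fun S hS => ?_⟩
  rw [Measure.map_apply hT.measurable hS, withDensity_apply _ (hT.measurable hS),
    withDensity_apply _ hS, ← hT.setLIntegral_comp_preimage hS hd]
  simp_rw [h]

theorem measurePreserving_shift (a : Rn n) :
    MeasurePreserving (fun p : Rn n × Rn n => (p.1 + a, p.2 + a)) volume volume :=
  (measurePreserving_add_right volume a).prod (measurePreserving_add_right volume a)

theorem measurePreserving_nu_shift (a : Rn n) :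
    MeasurePreserving (fun p : Rn n × Rn n => (p.1 + a, p.2 + a)) (nuMeasure n) (nuMeasure n) :=
  (measurePreserving_shift a).withDensity_of_comp_eq measurable_nuDensity (fun p => by simp)

theorem measurePreserving_nu_swap :
    MeasurePreserving (Prod.swap : Rn n × Rn n → Rn n × Rn n) (nuMeasure n) (nuMeasure n) :=
  (Measure.measurePreserving_swap (μ := (volume : Measure (Rn n)))
    (ν := (volume : Measure (Rn n)))).withDensity_of_comp_eq measurable_nuDensity
    (fun p => by simp [norm_sub_rev])

theorem measurable_holderQuot {s : ℝ} {v : Rn n → ℝ} (hv : Measurable v) :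
    Measurable (holderQuot s v) := by
  unfold holderQuot; fun_prop

theorem ae_prod_of_ae {P : Rn n → Prop} (h : ∀ᵐ x, P x) :
    ∀ᵐ p : Rn n × Rn n ∂volume, P p.1 ∧ P p.2 :=
  (Measure.quasiMeasurePreserving_fst.ae h).and (Measure.quasiMeasurePreserving_snd.ae h)

theorem ae_nu_of_ae {P : Rn n → Prop} (h : ∀ᵐ x, P x) :
    ∀ᵐ p ∂(nuMeasure n), P p.1 ∧ P p.2 :=
  nuMeasure_absolutelyContinuous.ae_le (ae_prod_of_ae h)

theorem holderQuot_ae_congr {s : ℝ} {v v' : Rn n → ℝ} (h : v =ᵐ[volume] v') :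
    holderQuot s v =ᵐ[nuMeasure n] holderQuot s v' :=
  (ae_nu_of_ae h).mono fun p hp => by simp only [holderQuot, hp.1, hp.2]

theorem MemWL.congr {A : ℝ → ℝ} {s : ℝ} {v v' : Rn n → ℝ} (h : MemWL A s v)
    (hv : v' =ᵐ[volume] v) : MemWL A s v' :=
  ⟨h.1.congr hv, h.2.congr (holderQuot_ae_congr hv)⟩

theorem pairing_congr {s : ℝ} {g : Rn n → ℝ} {G : Rn n × Rn n → ℝ} {v v' : Rn n → ℝ}
    (h : v =ᵐ[volume] v') : pairing s g G v = pairing s g G v' := by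
  unfold pairing
  congr 1
  · exact integral_congr_ae (h.mono fun x hx => by simp only [hx])
  · exact integral_congr_ae ((holderQuot_ae_congr (s := s) h).mono fun x hx => by
      simp only [hx])

/-! ## The kernel `min(|z|^{1-s}, |z|^{-s})` -/

/-- The kernel `min(|z|^{1-s}, |z|^{-s})` bounding the Hölder quotients of bounded Lipschitz
functions. -/
def holderKernel (s : ℝ) (z : Rn n) : ℝ := min (‖z‖ ^ (1 - s)) (‖z‖ ^ (-s))

theorem measurable_holderKernel {s : ℝ} : Measurable (holderKernel (n := n) s) := by
  unfold holderKernel; fun_prop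

theorem holderKernel_nonneg {s : ℝ} (z : Rn n) : 0 ≤ holderKernel s z := by
  unfold holderKernel; positivity

theorem holderKernel_neg {s : ℝ} (z : Rn n) : holderKernel s (-z) = holderKernel s z := by
  simp [holderKernel]

theorem holderKernel_le_one {s : ℝ} (hs0 : 0 < s) (hs1 : s < 1) (z : Rn n) :
    holderKernel s z ≤ 1 := by
  rcases le_total ‖z‖ 1 with h | h
  · exact (min_le_left _ _).trans (Real.rpow_le_one (norm_nonneg _) h (by linarith))
  · exact (min_le_right _ _).trans (Real.rpow_le_one_of_one_le_of_nonpos h (by linarith))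

/-- In polar coordinates the radial integrand is `min(r^{-s}, r^{-s-1})`: the first power is
integrable at 0 because `s < 1`, the second at infinity because `s > 0`. -/
theorem integrable_holderKernel (hn : 0 < n) {s : ℝ} (hs0 : 0 < s) (hs1 : s < 1) :
    Integrable (fun z : Rn n => holderKernel s z * (1 / ‖z‖ ^ n)) := by
  have : Nonempty (Fin n) := ⟨⟨0, hn⟩⟩
  have : Nontrivial (Rn n) := inferInstance
  have key := integrable_fun_norm_addHaar (volume : Measure (Rn n))
    (f := fun r : ℝ => min (r ^ (1 - s)) (r ^ (-s)) * (1 / r ^ n))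
  refine key.2 ?_
  simp only [finrank_euclideanSpace, Fintype.card_fin, smul_eq_mul]
  have e : EqOn (fun y : ℝ => min (y ^ (-s)) (y ^ (-s - 1)))
      (fun y : ℝ => y ^ (n - 1) * (min (y ^ (1 - s)) (y ^ (-s)) * (1 / y ^ n))) (Ioi 0) := by
    intro y hy
    have hy : 0 < y := hy
    obtain ⟨k, rfl⟩ : ∃ k, n = k + 1 := ⟨n - 1, by omega⟩
    have h1 : y ^ (1 - s) = y * y ^ (-s) := by
      rw [sub_eq_add_neg, Real.rpow_add hy, Real.rpow_one]
    have h2 : y ^ (-s - 1) = y⁻¹ * y ^ (-s) := by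
      rw [sub_eq_add_neg, Real.rpow_add hy, Real.rpow_neg_one, mul_comm]
    simp only [h1, h2, Nat.add_sub_cancel]
    have h3 : min (y * y ^ (-s)) (y ^ (-s)) = y * min (y ^ (-s)) (y⁻¹ * y ^ (-s)) := by
      rw [mul_min_of_nonneg _ _ hy.le, ← mul_assoc, mul_inv_cancel₀ hy.ne', one_mul]
    rw [h3, pow_succ]
    field_simp
  refine IntegrableOn.congr_fun ?_ e measurableSet_Ioi
  rw [← Ioc_union_Ioi_eq_Ioi zero_le_one]
  have hmeas : Measurable (fun y : ℝ => min (y ^ (-s)) (y ^ (-s - 1))) := by fun_prop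
  refine IntegrableOn.union ?_ ?_
  · have h := (intervalIntegral.intervalIntegrable_rpow' (a := 0) (b := 1) (r := -s)
      (by linarith)).1
    refine h.mono' hmeas.aestronglyMeasurable ?_
    refine (ae_restrict_mem measurableSet_Ioc).mono fun y hy => ?_
    have : 0 < y := hy.1
    rw [Real.norm_of_nonneg (by positivity)]
    exact min_le_left _ _
  · have h := integrableOn_Ioi_rpow_of_lt (a := -s - 1) (by linarith) (one_pos)
    refine h.mono' hmeas.aestronglyMeasurable ?_
    refine (ae_restrict_mem measurableSet_Ioi).mono fun y hy => ?_
    have : (0 : ℝ) < y := one_pos.trans hy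
    rw [Real.norm_of_nonneg (by positivity)]
    exact min_le_right _ _

/-- The total `ν`-mass of the kernel on a line `{x} × ℝⁿ`. -/
def kernelMass (n : ℕ) (s : ℝ) : ℝ≥0∞ :=
  ∫⁻ z : Rn n, ENNReal.ofReal (holderKernel s z) * ENNReal.ofReal (1 / ‖z‖ ^ n)

theorem kernelMass_lt_top (hn : 0 < n) {s : ℝ} (hs0 : 0 < s) (hs1 : s < 1) :
    kernelMass n s < ∞ := by
  have h := (integrable_holderKernel hn hs0 hs1).2
  rw [hasFiniteIntegral_iff_ofReal (ae_of_all _ fun z => by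
    have := holderKernel_nonneg (s := s) z; positivity)] at h
  refine lt_of_eq_of_lt (lintegral_congr fun z => ?_) h
  rw [ENNReal.ofReal_mul (holderKernel_nonneg z)]

/-- Tonelli's theorem and the substitution `z = x - y`. With `holderKernel_le_one` and convexity,
`A(κ t) ≤ κ A(t)`, this turns modulars on `ℝ²ⁿ` into modulars on `ℝⁿ`. -/
theorem lintegral_fst_mul_kernel {s : ℝ} {h : Rn n → ℝ≥0∞} (hh : AEMeasurable h) :
    ∫⁻ p, h p.1 * ENNReal.ofReal (holderKernel s (p.1 - p.2)) ∂(nuMeasure n) =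
      (∫⁻ x, h x) * kernelMass n s := by
  have hk : Measurable (holderKernel (n := n) s) := measurable_holderKernel
  have h1 : AEMeasurable (fun p : Rn n × Rn n => h p.1) volume :=
    hh.comp_quasiMeasurePreserving Measure.quasiMeasurePreserving_fst
  have hk' : Measurable fun p : Rn n × Rn n => holderKernel s (p.1 - p.2) := by fun_prop
  rw [lintegral_nuMeasure, Measure.volume_eq_prod, lintegral_prod]
  · rw [← lintegral_mul_const'' _ hh]
    refine lintegral_congr fun x => ?_
    simp only
    rw [← lintegral_sub_left_eq_self (fun z : Rn n => ENNReal.ofReal (1 / ‖x - z‖ ^ n) *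
      (h x * ENNReal.ofReal (holderKernel s (x - z)))) x]
    simp only [sub_sub_cancel]
    rw [kernelMass, ← lintegral_const_mul _ (by fun_prop)]
    refine lintegral_congr fun z => ?_
    ring
  · exact measurable_nuDensity.aemeasurable.mul (h1.mul hk'.ennreal_ofReal.aemeasurable)

theorem lintegral_snd_mul_kernel {s : ℝ} {h : Rn n → ℝ≥0∞} (hh : AEMeasurable h) :
    ∫⁻ p, h p.2 * ENNReal.ofReal (holderKernel s (p.1 - p.2)) ∂(nuMeasure n) =
      (∫⁻ x, h x) * kernelMass n s := by
  rw [← lintegral_fst_mul_kernel hh]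
  rw [← (measurePreserving_nu_swap (n := n)).lintegral_comp_emb
    (MeasurableEquiv.prodComm (α := Rn n) (β := Rn n)).measurableEmbedding]
  refine lintegral_congr fun p => ?_
  simp only [Prod.fst_swap, Prod.snd_swap]
  rw [← holderKernel_neg, neg_sub]

theorem abs_holderQuot_le_kernel {s : ℝ} (hs0 : 0 < s) (hs1 : s < 1) {η : Rn n → ℝ} {L : ℝ}
    (hL : ∀ x y, |η x - η y| ≤ L * ‖x - y‖) (hB : ∀ x y, |η x - η y| ≤ L) (p : Rn n × Rn n) :
    |holderQuot s η p| ≤ L * holderKernel s (p.1 - p.2) := by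
  have hL0 : 0 ≤ L := (abs_nonneg _).trans (hB 0 0)
  unfold holderQuot holderKernel
  rw [mul_min_of_nonneg _ _ hL0, abs_div, abs_of_nonneg (by positivity : 0 ≤ ‖p.1 - p.2‖ ^ s)]
  rcases (norm_nonneg (p.1 - p.2)).eq_or_lt with h | h
  -- On the diagonal both sides are 0: real powers of 0 with nonzero exponent are 0, and so is
  -- division by 0.
  · rw [← h, Real.zero_rpow hs0.ne', Real.zero_rpow (by linarith), Real.zero_rpow (by linarith)]
    simp
  · rw [div_eq_mul_inv, ← Real.rpow_neg h.le]
    refine le_min ?_ ?_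
    · rw [show 1 - s = 1 + -s by ring, Real.rpow_add h, Real.rpow_one, ← mul_assoc]
      gcongr
      exact hL _ _
    · gcongr
      exact hB _ _

/-! ### Lipschitz multipliers, translations and test functions in the Sobolev spaces -/

section Sobolev

variable {A : ℝ → ℝ} {s : ℝ}

/-- The quotient vanishes unless one of the two points lies in the support, and it is bounded by `L`
times the kernel; convexity pulls the kernel out of `A`. Finiteness for every `k` is what replaces a
Δ₂-condition for test functions. -/
theorem modular_holderQuot_lt_top (hn : 0 < n) (hs0 : 0 < s) (hs1 : s < 1) (hA : IsYoungLike A)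
    {η : Rn n → ℝ} {L : ℝ} (hL : ∀ x y, |η x - η y| ≤ L * ‖x - y‖)
    (hB : ∀ x y, |η x - η y| ≤ L) (hc : HasCompactSupport η) (k : ℝ) :
    modular A (nuMeasure n) (fun p => holderQuot s η p / k) < ∞ := by
  have hL0 : 0 ≤ L := (abs_nonneg _).trans (hB 0 0)
  set S := tsupport η
  have hSm : MeasurableSet S := (isClosed_tsupport η).measurableSet
  set h : Rn n → ℝ≥0∞ := S.indicator (fun _ => ENNReal.ofReal (A (L / k)))
  have hhm : Measurable h := measurable_const.indicator hSm
  have hfin : ∫⁻ x, h x < ∞ := by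
    rw [lintegral_indicator hSm, lintegral_const, Measure.restrict_apply_univ]
    exact ENNReal.mul_lt_top ENNReal.ofReal_lt_top hc.isCompact.measure_lt_top
  have hle : modular A (nuMeasure n) (fun p => holderQuot s η p / k) ≤
      ∫⁻ p, (h p.1 * ENNReal.ofReal (holderKernel s (p.1 - p.2)) +
        h p.2 * ENNReal.ofReal (holderKernel s (p.1 - p.2))) ∂(nuMeasure n) := by
    refine lintegral_mono fun p => ?_
    simp only
    by_cases hp : p.1 ∈ S ∨ p.2 ∈ S
    · have h1 : ENNReal.ofReal (A (L / k)) ≤ h p.1 + h p.2 := by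
        rcases hp with hp | hp
        · simp only [h, indicator_of_mem hp]; exact le_self_add
        · simp only [h, indicator_of_mem hp]; exact le_add_self
      rw [← add_mul]
      refine le_trans ?_ (mul_le_mul_left h1 _)
      rw [← ENNReal.ofReal_mul (hA.nonneg _)]
      refine ENNReal.ofReal_le_ofReal ?_
      rw [mul_comm]
      refine le_trans (hA.mono _ _ ?_)
        (hA.mul_le (holderKernel_nonneg _) (holderKernel_le_one hs0 hs1 _) _)
      rw [abs_div, abs_mul, abs_div, abs_of_nonneg hL0, abs_of_nonneg (holderKernel_nonneg _),
        ← mul_div_assoc, mul_comm (holderKernel s _)]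
      gcongr
      exact abs_holderQuot_le_kernel hs0 hs1 hL hB p
    · push Not at hp
      have h1 : holderQuot s η p = 0 := by
        simp [holderQuot, image_eq_zero_of_notMem_tsupport hp.1,
          image_eq_zero_of_notMem_tsupport hp.2]
      rw [h1, zero_div, hA.zero]; simp
  refine hle.trans_lt ?_
  rw [lintegral_add_left' ?_, lintegral_fst_mul_kernel hhm.aemeasurable,
    lintegral_snd_mul_kernel hhm.aemeasurable]
  · have := ENNReal.mul_lt_top hfin (kernelMass_lt_top hn hs0 hs1)
    exact ENNReal.add_lt_top.2 ⟨this, this⟩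
  · have := measurable_holderKernel (n := n) (s := s)
    fun_prop

theorem memOrlicz_kernel_mul (hn : 0 < n) (hs0 : 0 < s) (hs1 : s < 1) (hA : IsYoungLike A)
    {v : Rn n → ℝ} (hv : MemOrlicz A volume v) :
    MemOrlicz A (nuMeasure n) (fun p => holderKernel s (p.1 - p.2) * v p.2) := by
  obtain ⟨hvm, k, hk, hfin⟩ := hv
  have hkm := measurable_holderKernel (n := n) (s := s)
  have hv2 : AEMeasurable (fun p : Rn n × Rn n => v p.2) (nuMeasure n) :=
    (hvm.comp_quasiMeasurePreserving Measure.quasiMeasurePreserving_snd).mono_ac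
      nuMeasure_absolutelyContinuous
  refine ⟨(by fun_prop : AEMeasurable (fun p : Rn n × Rn n => holderKernel s (p.1 - p.2))
    (nuMeasure n)).mul hv2, k, hk, ?_⟩
  have hle : modular A (nuMeasure n) (fun p => holderKernel s (p.1 - p.2) * v p.2 / k) ≤
      ∫⁻ p, ENNReal.ofReal (A (v p.2 / k)) * ENNReal.ofReal (holderKernel s (p.1 - p.2))
        ∂(nuMeasure n) := by
    refine lintegral_mono fun p => ?_
    simp only
    rw [← ENNReal.ofReal_mul (hA.nonneg _), mul_comm (A _), mul_div_assoc]
    exact ENNReal.ofReal_le_ofReal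
      (hA.mul_le (holderKernel_nonneg _) (holderKernel_le_one hs0 hs1 _) _)
  refine hle.trans_lt ?_
  rw [lintegral_snd_mul_kernel (h := fun x => ENNReal.ofReal (A (v x / k)))
    (hA.measurable.comp_aemeasurable (hvm.div_const k)).ennreal_ofReal]
  exact ENNReal.mul_lt_top hfin (kernelMass_lt_top hn hs0 hs1)

/-- This controls the second term of the product rule `holderQuot_mul`: the kernel bound on `Dˢη`
leaves only `v(y)` to be integrated. -/
theorem memOrlicz_mul_holderQuot (hn : 0 < n) (hs0 : 0 < s) (hs1 : s < 1) (hA : IsYoungLike A)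
    {η : Rn n → ℝ} (hη : Measurable η) {L : ℝ} (hL : ∀ x y, |η x - η y| ≤ L * ‖x - y‖)
    (hB : ∀ x y, |η x - η y| ≤ L) {v : Rn n → ℝ} (hv : MemOrlicz A volume v) :
    MemOrlicz A (nuMeasure n) (fun p => v p.2 * holderQuot s η p) := by
  have hv2 : AEMeasurable (fun p : Rn n × Rn n => v p.2) (nuMeasure n) :=
    (hv.1.comp_quasiMeasurePreserving Measure.quasiMeasurePreserving_snd).mono_ac
      nuMeasure_absolutelyContinuous
  refine (memOrlicz_kernel_mul hn hs0 hs1 hA hv).of_le_mul hA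
    (hv2.mul (measurable_holderQuot hη).aemeasurable) (C := L) (ae_of_all _ fun p => ?_)
  rw [abs_mul, abs_mul, abs_of_nonneg (holderKernel_nonneg _), mul_comm, ← mul_assoc]
  gcongr
  exact abs_holderQuot_le_kernel hs0 hs1 hL hB p

theorem holderQuot_mul (η v : Rn n → ℝ) (p : Rn n × Rn n) :
    holderQuot s (fun x => η x * v x) p =
      η p.1 * holderQuot s v p + v p.2 * holderQuot s η p := by
  unfold holderQuot; ring

theorem holderQuot_add (u v : Rn n → ℝ) (p : Rn n × Rn n) :
    holderQuot s (fun x => u x + v x) p = holderQuot s u p + holderQuot s v p := by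
  unfold holderQuot; ring

/-- Multiplication by bounded Lipschitz functions preserves `WˢL_A`. -/
theorem MemWL.mul_lipschitz (hn : 0 < n) (hs0 : 0 < s) (hs1 : s < 1) (hA : IsYoungLike A)
    {η : Rn n → ℝ} (hη : Measurable η) {L : ℝ} (hL : ∀ x y, |η x - η y| ≤ L * ‖x - y‖)
    (hB : ∀ x y, |η x - η y| ≤ L) {C : ℝ} (hC : ∀ x, |η x| ≤ C) {v : Rn n → ℝ}
    (hv : MemWL A s v) : MemWL A s (fun x => η x * v x) := by
  refine ⟨hv.1.of_le_mul hA (hη.aemeasurable.mul hv.1.1) (C := C) (ae_of_all _ fun x => ?_), ?_⟩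
  · rw [abs_mul]; gcongr; exact hC x
  · have h1 : MemOrlicz A (nuMeasure n) (fun p => η p.1 * holderQuot s v p) := by
      refine hv.2.of_le_mul hA
        ((hη.comp measurable_fst).aemeasurable.mul hv.2.1) (C := C) (ae_of_all _ fun p => ?_)
      rw [abs_mul]; gcongr; exact hC _
    have h2 := h1.add hA (memOrlicz_mul_holderQuot (s := s) hn hs0 hs1 hA hη hL hB hv.1)
    exact h2.congr (ae_of_all _ fun p => holderQuot_mul η v p)

theorem holderQuot_shift (a : Rn n) (v : Rn n → ℝ) (p : Rn n × Rn n) :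
    holderQuot s (fun x => v (x + a)) p = holderQuot s v (p.1 + a, p.2 + a) := by
  simp [holderQuot]

theorem MemWL.shift (hA : IsYoungLike A) {v : Rn n → ℝ} (hv : MemWL A s v) (a : Rn n) :
    MemWL A s (fun x => v (x + a)) := by
  refine ⟨hv.1.comp hA (measurePreserving_add_right volume a), ?_⟩
  exact (hv.2.comp hA (measurePreserving_nu_shift a)).congr
    (ae_of_all _ fun p => holderQuot_shift a v p)

theorem exists_lipschitz_of_contDiff {η : Rn n → ℝ} (h : ContDiff ℝ 1 η)
    (hc : HasCompactSupport η) :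
    ∃ L : ℝ, (∀ x y, |η x - η y| ≤ L * ‖x - y‖) ∧ (∀ x y, |η x - η y| ≤ L) ∧ ∀ x, |η x| ≤ L := by
  obtain ⟨C, hC⟩ := h.lipschitzWith_of_hasCompactSupport hc (by norm_num)
  obtain ⟨B, hB⟩ := h.continuous.bounded_above_of_compact_support hc
  have hB0 : 0 ≤ B := (norm_nonneg _).trans (hB 0)
  refine ⟨max (C : ℝ) (2 * B), fun x y => ?_, fun x y => ?_, fun x => ?_⟩
  · have := hC.dist_le_mul x y
    rw [Real.dist_eq, dist_eq_norm] at this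
    exact this.trans (by gcongr; exact le_max_left _ _)
  · have h1 := hB x
    have h2 := hB y
    rw [Real.norm_eq_abs] at h1 h2
    exact ((abs_sub _ _).trans (by linarith)).trans (le_max_right _ _)
  · have h1 := hB x
    rw [Real.norm_eq_abs] at h1
    exact (h1.trans (by linarith)).trans (le_max_right _ _)

theorem memOrliczE_test (hA : IsYoungLike A) {η : Rn n → ℝ} (h : Continuous η)
    (hc : HasCompactSupport η) : MemOrliczE A volume η := by
  obtain ⟨B, hB⟩ := h.bounded_above_of_compact_support hc
  refine memOrliczE_of_bounded hA h.measurable (C := B) hB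
    (hc.isCompact.isBounded.subset subset_closure)
    ((measure_mono subset_closure).trans_lt hc.isCompact.measure_lt_top)

theorem nuMeasure_le_of_le_norm {S : Set (Rn n × Rn n)} (hS : MeasurableSet S) {δ : ℝ}
    (hδ : 0 < δ) (h : ∀ p ∈ S, δ ≤ ‖p.1 - p.2‖) :
    nuMeasure n S ≤ ENNReal.ofReal (1 / δ ^ n) * volume S := by
  rw [nuMeasure, withDensity_apply _ hS, ← setLIntegral_const]
  refine setLIntegral_mono measurable_const fun p hp => ENNReal.ofReal_le_ofReal ?_
  have := h p hp
  gcongr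

theorem memOrliczE_holderQuot_test (hn : 0 < n) (hs0 : 0 < s) (hs1 : s < 1) (hA : IsYoungLike A)
    {η : Rn n → ℝ} (h : ContDiff ℝ 1 η) (hc : HasCompactSupport η) :
    MemOrliczE A (nuMeasure n) (holderQuot s η) := by
  obtain ⟨L, hL, hB, hC⟩ := exists_lipschitz_of_contDiff h hc
  have hmod := fun k => modular_holderQuot_lt_top hn hs0 hs1 hA hL hB hc k
  have hηm : Measurable (holderQuot s η) := measurable_holderQuot h.continuous.measurable
  refine ⟨memOrlicz_of_modular hηm.aemeasurable (by simpa using hmod 1), fun ε hε => ?_⟩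
  -- Cutting off a neighbourhood of the diagonal and of infinity leaves a bounded set of finite
  -- `ν_n`-measure. The modular of the remainder divided by `ε/2` tends to 0; once it is at most 1,
  -- the Luxemburg norm is at most `ε/2`.
  set S : ℕ → Set (Rn n × Rn n) := fun j => {p | ‖p‖ ≤ j ∧ 1 / ((j : ℝ) + 1) ≤ ‖p.1 - p.2‖}
  have hSm : ∀ j, MeasurableSet (S j) := fun j =>
    (measurableSet_le measurable_norm measurable_const).inter
      (measurableSet_le (f := fun _ => 1 / ((j : ℝ) + 1)) measurable_const
        (measurable_fst.sub measurable_snd).norm)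
  have hlim : Tendsto (fun j => modular A (nuMeasure n)
      (fun p => (holderQuot s η p - (S j).indicator (holderQuot s η) p) / (ε / 2)))
      atTop (𝓝 (∫⁻ _, 0 ∂(nuMeasure n))) := by
    unfold modular
    refine tendsto_lintegral_of_dominated_convergence
      (fun p => ENNReal.ofReal (A (holderQuot s η p / (ε / 2)))) (fun j => ?_) (fun j => ?_)
      (hmod (ε / 2)).ne ?_
    · have := hA.measurable
      have := hηm.indicator (hSm j)
      fun_prop
    · refine ae_of_all _ fun p => ENNReal.ofReal_le_ofReal (hA.mono _ _ ?_)
      by_cases hp : p ∈ S j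
      · simp only [indicator_of_mem hp, sub_self, zero_div, abs_zero]; positivity
      · simp only [indicator_of_notMem hp, sub_zero, le_refl]
    · refine ae_of_all _ fun p => ?_
      refine tendsto_const_nhds.congr' ?_
      by_cases hp : p.1 = p.2
      · refine Eventually.of_forall fun j => ?_
        have : holderQuot s η p = 0 := by simp [holderQuot, hp]
        by_cases hpj : p ∈ S j <;> simp [hpj, this, hA.zero]
      · have h1 : 0 < ‖p.1 - p.2‖ := norm_pos_iff.2 (sub_ne_zero.2 hp)
        have h2 := tendsto_one_div_add_atTop_nhds_zero_nat (𝕜 := ℝ)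
        filter_upwards [h2.eventually_le_const h1,
          tendsto_natCast_atTop_atTop.eventually_ge_atTop ‖p‖] with j hj1 hj2
        have : p ∈ S j := ⟨hj2, hj1⟩
        simp [this, hA.zero]
  rw [lintegral_zero] at hlim
  obtain ⟨j, hj⟩ := (hlim.eventually_le_const one_pos).exists
  have hsub : Function.support ((S j).indicator (holderQuot s η)) ⊆ S j :=
    support_indicator_subset
  have hSb : S j ⊆ Metric.closedBall 0 j := fun p hp => by simpa using hp.1
  refine ⟨(S j).indicator (holderQuot s η), hηm.indicator (hSm j), ⟨L, fun p => ?_⟩,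
    Metric.isBounded_closedBall.subset (hsub.trans hSb), ?_, ?_⟩
  · have hL0 : 0 ≤ L := (abs_nonneg _).trans (hB 0 0)
    by_cases hp : p ∈ S j
    · rw [indicator_of_mem hp]
      refine (abs_holderQuot_le_kernel hs0 hs1 hL hB p).trans ?_
      have := holderKernel_le_one hs0 hs1 (p.1 - p.2)
      nlinarith
    · simpa [hp] using hL0
  · refine (measure_mono hsub).trans_lt ?_
    refine (nuMeasure_le_of_le_norm (hSm j) (δ := 1 / ((j : ℝ) + 1)) (by positivity)
      fun p hp => hp.2).trans_lt ?_
    exact ENNReal.mul_lt_top ENNReal.ofReal_lt_top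
      ((measure_mono hSb).trans_lt (isCompact_closedBall _ _).measure_lt_top)
  · exact (luxNorm_le (by positivity) hj).trans_lt (by linarith)

theorem contDiff_one_test {Ω : Opens (Rn n)} (φ : 𝓓(Ω, ℝ)) : ContDiff ℝ 1 φ :=
  φ.contDiff.of_le (by simp)

theorem memWE_test (hn : 0 < n) (hs0 : 0 < s) (hs1 : s < 1) (hA : IsYoungLike A)
    {Ω : Opens (Rn n)} (φ : 𝓓(Ω, ℝ)) : MemWE A s φ :=
  ⟨memOrliczE_test hA φ.continuous φ.hasCompactSupport,
    memOrliczE_holderQuot_test hn hs0 hs1 hA (contDiff_one_test φ) φ.hasCompactSupport⟩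

theorem memWL_test (hn : 0 < n) (hs0 : 0 < s) (hs1 : s < 1) (hA : IsYoungLike A)
    {Ω : Opens (Rn n)} (φ : 𝓓(Ω, ℝ)) : MemWL A s φ :=
  ⟨(memWE_test hn hs0 hs1 hA φ).1.1, (memWE_test hn hs0 hs1 hA φ).2.1⟩

theorem memW0E_test (hn : 0 < n) (hs0 : 0 < s) (hs1 : s < 1) {m : ℝ → ℝ} (hm : IsYoungDensity m)
    {Ω : Opens (Rn n)} (φ : 𝓓(Ω, ℝ)) : MemW0E m s Ω φ := by
  refine ⟨memWE_test hn hs0 hs1 hm.isYoungLike φ, fun ε hε => ⟨φ, ?_⟩⟩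
  have : holderQuot (n := n) s (fun x => φ x - φ x) = fun _ => 0 := by
    ext p; simp [holderQuot]
  rw [this]
  simpa [luxNorm_zero hm.isYoungLike] using hε

end Sobolev

/-! ## Fatou's lemma and weak continuity of translations -/

section Fatou

variable {X : Type*} [MeasurableSpace X] {μ : Measure X}

/-- Fatou's lemma for nonnegative real functions with frequently bounded integrals. -/
theorem integral_le_of_tendsto_ae {F : ℕ → X → ℝ} {f : X → ℝ} {C : ℝ}
    (hF : ∀ j, Integrable (F j) μ) (hF0 : ∀ j, ∀ᵐ x ∂μ, 0 ≤ F j x)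
    (hlim : ∀ᵐ x ∂μ, Tendsto (fun j => F j x) atTop (𝓝 (f x)))
    (hC : ∃ᶠ j in atTop, ∫ x, F j x ∂μ ≤ C) : Integrable f μ ∧ ∫ x, f x ∂μ ≤ C := by
  have hf0 : ∀ᵐ x ∂μ, 0 ≤ f x := by
    filter_upwards [ae_all_iff.2 hF0, hlim] with x h1 h2
    exact ge_of_tendsto' h2 h1
  have hC0 : 0 ≤ C := by
    obtain ⟨j, hj⟩ := hC.exists
    exact (integral_nonneg_of_ae (hF0 j)).trans hj
  have hfm : AEStronglyMeasurable f μ :=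
    aestronglyMeasurable_of_tendsto_ae _ (fun j => (hF j).1) hlim
  have key : ∫⁻ x, ENNReal.ofReal (f x) ∂μ ≤ ENNReal.ofReal C := by
    calc ∫⁻ x, ENNReal.ofReal (f x) ∂μ
        = ∫⁻ x, liminf (fun j => ENNReal.ofReal (F j x)) atTop ∂μ := by
          refine lintegral_congr_ae (hlim.mono fun x hx => ?_)
          exact ((ENNReal.continuous_ofReal.tendsto _).comp hx).liminf_eq.symm
      _ ≤ liminf (fun j => ∫⁻ x, ENNReal.ofReal (F j x) ∂μ) atTop :=
          lintegral_liminf_le' fun j => (hF j).1.aemeasurable.ennreal_ofReal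
      _ ≤ ENNReal.ofReal C := by
          refine liminf_le_of_frequently_le' (hC.mono fun j hj => ?_)
          rw [← ofReal_integral_eq_lintegral_ofReal (hF j) (hF0 j)]
          exact ENNReal.ofReal_le_ofReal hj
  have hfi : Integrable f μ :=
    ⟨hfm, by
      rw [hasFiniteIntegral_iff_ofReal hf0]
      exact key.trans_lt ENNReal.ofReal_lt_top⟩
  refine ⟨hfi, ?_⟩
  rw [← ofReal_integral_eq_lintegral_ofReal hfi hf0] at key
  exact (ENNReal.ofReal_le_ofReal_iff hC0).1 key

/-- Dominated convergence with a converging sequence of dominating functions of equal integral. -/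
theorem tendsto_integral_of_dominated_of_integral_eq {F H : ℕ → X → ℝ} {f h : X → ℝ}
    (hF : ∀ j, AEStronglyMeasurable (F j) μ) (hH : ∀ j, Integrable (H j) μ) (hh : Integrable h μ)
    (hle : ∀ j, ∀ᵐ x ∂μ, |F j x| ≤ H j x)
    (hFf : ∀ᵐ x ∂μ, Tendsto (fun j => F j x) atTop (𝓝 (f x)))
    (hHh : ∀ᵐ x ∂μ, Tendsto (fun j => H j x) atTop (𝓝 (h x)))
    (heq : ∀ j, ∫ x, H j x ∂μ = ∫ x, h x ∂μ) :
    Tendsto (fun j => ∫ x, F j x ∂μ) atTop (𝓝 (∫ x, f x ∂μ)) := by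
  have hFi : ∀ j, Integrable (F j) μ := fun j => (hH j).mono' (hF j) (hle j)
  have hfi : Integrable f μ := by
    refine hh.mono' (aestronglyMeasurable_of_tendsto_ae _ hF hFf) ?_
    filter_upwards [ae_all_iff.2 hle, hFf, hHh] with x h1 h2 h3
    exact le_of_tendsto_of_tendsto' h2.abs h3 h1
  have lower : ∀ {F : ℕ → X → ℝ} {f : X → ℝ}, (∀ j, Integrable (F j) μ) → Integrable f μ →
      (∀ j, ∀ᵐ x ∂μ, |F j x| ≤ H j x) →
      (∀ᵐ x ∂μ, Tendsto (fun j => F j x) atTop (𝓝 (f x))) → ∀ c < ∫ x, f x ∂μ,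
      ∀ᶠ j in atTop, c < ∫ x, F j x ∂μ := by
    intro F f hF hf hle hFf c hc
    -- If `∫ F_j ≤ c` infinitely often, Fatou's lemma for `H_j + F_j ≥ 0` gives `∫ h + ∫ f ≤ ∫ h +
    -- c`, contradicting `c < ∫ f`.
    by_contra hcon
    rw [not_eventually] at hcon
    have := integral_le_of_tendsto_ae (F := fun j x => H j x + F j x)
      (f := fun x => h x + f x) (μ := μ) (C := ∫ x, h x ∂μ + c)
      (fun j => (hH j).add (hF j))
      (fun j => (hle j).mono fun x hx => by linarith [neg_abs_le (F j x)])
      (by filter_upwards [hFf, hHh] with x h1 h2 using h2.add h1)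
      (hcon.mono fun j hj => by
        rw [integral_add (hH j) (hF j), heq j]
        linarith [not_lt.1 hj])
    have h2 := this.2
    rw [integral_add hh hf] at h2
    linarith
  refine tendsto_order.2 ⟨lower hFi hfi hle hFf, fun c hc => ?_⟩
  have := lower (F := fun j x => - F j x) (f := fun x => - f x) (fun j => (hFi j).neg) hfi.neg
    (fun j => by simpa using hle j) (hFf.mono fun x hx => hx.neg) (-c)
    (by rw [integral_neg]; linarith)
  refine this.mono fun j hj => ?_
  rw [integral_neg] at hj
  linarith

end Fatou

/-- Translation is continuous in `L¹`; convergence in `L¹` implies convergence in measure, hence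
a.e. along a subsequence. -/
theorem exists_subseq_ae_tendsto_translate {w : Rn n → ℝ} (hw : Integrable w) {a : ℕ → Rn n}
    (ha : Tendsto a atTop (𝓝 0)) : ∃ ns : ℕ → ℕ, Tendsto ns atTop atTop ∧
      ∀ᵐ x, Tendsto (fun j => w (x + a (ns j))) atTop (𝓝 (w x)) := by
  let f : Lp ℝ 1 (volume : Measure (Rn n)) := (memLp_one_iff_integrable.2 hw).toLp w
  have hf : f =ᵐ[volume] w := MemLp.coeFn_toLp _
  let T : Rn n → C(Rn n, Rn n) := fun b => ⟨fun x => x + b, by fun_prop⟩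
  have hT : Continuous T :=
    ContinuousMap.continuous_of_continuous_uncurry _ (by
      simp only [Function.uncurry_def, T, ContinuousMap.coe_mk]; fun_prop)
  have hTm : ∀ b, MeasurePreserving (T b) volume volume :=
    fun b => measurePreserving_add_right volume b
  have h1 := (continuous_const (y := f)).compMeasurePreservingLp hT hTm (by simp)
  have h2 := tendstoInMeasure_of_tendsto_Lp ((h1.tendsto 0).comp ha)
  obtain ⟨ns, hns, hae⟩ := h2.exists_seq_tendsto_ae
  refine ⟨ns, hns.tendsto_atTop, ?_⟩
  have e : ∀ b, Lp.compMeasurePreserving (T b) (hTm b) f =ᵐ[volume] fun x => w (x + b) := by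
    intro b
    refine (Lp.coeFn_compMeasurePreserving f (hTm b)).trans ?_
    exact (hTm b).quasiMeasurePreserving.ae_eq_comp hf
  have e' := ae_all_iff.2 fun j => e (a (ns j))
  filter_upwards [hae, e', e 0] with x hx h3 h4
  simp only [Function.comp_apply] at hx
  simp only [h3, h4, add_zero] at hx
  exact hx

section Translation

variable {m : ℝ → ℝ} {s : ℝ}

/-- If `F ∘ T_j → F` a.e. for measure preserving maps `T_j`, then `∫ G (F ∘ T_j) → ∫ G F` for
`F ∈ L_M` and `G ∈ L_M̅`. -/
theorem tendsto_integral_mul_comp {X : Type*} [MeasurableSpace X] {μ : Measure X}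
    (hm : IsYoungDensity m) {G F : X → ℝ} (hG : MemOrlicz (complementaryFn (youngFn m)) μ G)
    (hF : MemOrlicz (youngFn m) μ F) {T : ℕ → X → X} (hT : ∀ j, MeasurePreserving (T j) μ μ)
    (hlim : ∀ᵐ x ∂μ, Tendsto (fun j => F (T j x)) atTop (𝓝 (F x))) :
    Tendsto (fun j => ∫ x, G x * F (T j x) ∂μ) atTop (𝓝 (∫ x, G x * F x ∂μ)) := by
  obtain ⟨k, hk, hGi⟩ := hG.integrable_modular hm.isYoungLike_complementary
  obtain ⟨l, hl, hFi⟩ := hF.integrable_modular hm.isYoungLike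
  have hM := hm.isYoungLike
  have hFT : ∀ j, Integrable (fun x => youngFn m (F (T j x) / l)) μ := fun j =>
    (hT j).integrable_comp_of_integrable (g := fun x => youngFn m (F x / l)) hFi
  have hint : ∀ j, ∫ x, youngFn m (F (T j x) / l) ∂μ = ∫ x, youngFn m (F x / l) ∂μ := by
    intro j
    have h1 := (hT j).map_eq
    conv_rhs => rw [← h1]
    rw [integral_map (hT j).measurable.aemeasurable (by rw [h1]; exact hFi.1)]
  -- The majorant from Young's inequality moves with `j`, but its integral does not, because `T_j`
  -- preserves the measure.
  refine tendsto_integral_of_dominated_of_integral_eq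
    (H := fun j x => (k * l) * (complementaryFn (youngFn m) (G x / k) +
      youngFn m (F (T j x) / l)))
    (h := fun x => (k * l) * (complementaryFn (youngFn m) (G x / k) + youngFn m (F x / l)))
    (fun j => (hG.1.mul (hF.1.comp_quasiMeasurePreserving
      (hT j).quasiMeasurePreserving)).aestronglyMeasurable)
    (fun j => (hGi.add (hFT j)).const_mul _) ((hGi.add hFi).const_mul _)
    (fun j => ae_of_all _ fun x => ?_) (hlim.mono fun x hx => hx.const_mul _)
    (hlim.mono fun x hx => ?_) (fun j => ?_)
  · have h := hm.young (G x / k) (F (T j x) / l)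
    have e : G x * F (T j x) = (k * l) * (G x / k * (F (T j x) / l)) := by field_simp
    rw [e, abs_mul, abs_of_pos (mul_pos hk hl)]
    exact mul_le_mul_of_nonneg_left h (by positivity)
  · exact (tendsto_const_nhds.add ((hM.continuous.tendsto _).comp (hx.div_const l))).const_mul _
  · rw [integral_const_mul, integral_const_mul, integral_add hGi (hFT j), integral_add hGi hFi,
      hint j]

theorem tendsto_pairing_shift (hm : IsYoungDensity m) {g : Rn n → ℝ} {G : Rn n × Rn n → ℝ}
    (hg : MemOrlicz (complementaryFn (youngFn m)) volume g)
    (hG : MemOrlicz (complementaryFn (youngFn m)) (nuMeasure n) G) {w : Rn n → ℝ}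
    (hw : MemWL (youngFn m) s w) (hwi : Integrable w) :
    Tendsto (fun a => pairing s g G fun x => w (x + a)) (𝓝 0) (𝓝 (pairing s g G w)) := by
  refine tendsto_of_subseq_tendsto fun a ha => ?_
  obtain ⟨ns, -, hns⟩ := exists_subseq_ae_tendsto_translate hwi ha
  refine ⟨ns, ?_⟩
  unfold pairing
  refine Tendsto.add ?_ ?_
  · exact tendsto_integral_mul_comp hm hg hw.1
      (fun j => measurePreserving_add_right volume (a (ns j))) hns
  · simp only [holderQuot_shift]
    refine tendsto_integral_mul_comp hm hG hw.2
      (fun j => measurePreserving_nu_shift (a (ns j))) ?_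
    refine (ae_nu_of_ae hns).mono fun p hp => ?_
    exact (hp.1.sub hp.2).div_const _ |>.congr fun j => by simp [holderQuot]

theorem continuous_pairing_shift (hm : IsYoungDensity m) {g : Rn n → ℝ} {G : Rn n × Rn n → ℝ}
    (hg : MemOrlicz (complementaryFn (youngFn m)) volume g)
    (hG : MemOrlicz (complementaryFn (youngFn m)) (nuMeasure n) G) {w : Rn n → ℝ}
    (hw : MemWL (youngFn m) s w) (hwi : Integrable w) :
    Continuous fun a => pairing s g G fun x => w (x + a) := by
  refine continuous_iff_continuousAt.2 fun b => ?_
  have h := tendsto_pairing_shift (s := s) hm hg hG (hw.shift hm.isYoungLike b)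
    (hwi.comp_add_right b)
  have h2 : Tendsto (fun a : Rn n => a - b) (𝓝 b) (𝓝 0) := by
    have : Tendsto (fun a : Rn n => a - b) (𝓝 b) (𝓝 (b - b)) :=
      (continuous_id.sub continuous_const).tendsto b
    simpa using this
  refine (h.comp h2).congr fun a => ?_
  simp only [Function.comp_apply, add_assoc, sub_add_cancel]

end Translation

/-! ## Pairings with functions of `W₀ˢL_M(Ω)` -/

section Pairing

variable {m : ℝ → ℝ} {s : ℝ}

theorem pairing_add (hm : IsYoungDensity m) {g : Rn n → ℝ} {G : Rn n × Rn n → ℝ}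
    (hg : MemOrlicz (complementaryFn (youngFn m)) volume g)
    (hG : MemOrlicz (complementaryFn (youngFn m)) (nuMeasure n) G) {u v : Rn n → ℝ}
    (hu : MemWL (youngFn m) s u) (hv : MemWL (youngFn m) s v) :
    pairing s g G (fun x => u x + v x) = pairing s g G u + pairing s g G v := by
  unfold pairing
  simp only [holderQuot_add, mul_add]
  rw [integral_add (hg.integrable_mul hm hu.1) (hg.integrable_mul hm hv.1),
    integral_add (hG.integrable_mul hm hu.2) (hG.integrable_mul hm hv.2)]
  ring

theorem pairing_sub_left (hm : IsYoungDensity m) {g g' : Rn n → ℝ} {G G' : Rn n × Rn n → ℝ}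
    (hg : MemOrlicz (complementaryFn (youngFn m)) volume g)
    (hG : MemOrlicz (complementaryFn (youngFn m)) (nuMeasure n) G)
    (hg' : MemOrlicz (complementaryFn (youngFn m)) volume g')
    (hG' : MemOrlicz (complementaryFn (youngFn m)) (nuMeasure n) G') {u : Rn n → ℝ}
    (hu : MemWL (youngFn m) s u) :
    pairing s (fun x => g x - g' x) (fun p => G p - G' p) u =
      pairing s g G u - pairing s g' G' u := by
  unfold pairing
  simp only [sub_mul]
  rw [integral_sub (hg.integrable_mul hm hu.1) (hg'.integrable_mul hm hu.1),
    integral_sub (hG.integrable_mul hm hu.2) (hG'.integrable_mul hm hu.2)]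
  ring

/-- A Young function dominates `|t|` up to additive and multiplicative constants, and constants are
integrable on sets of finite measure. -/
theorem MemOrlicz.integrableOn {X : Type*} [MeasurableSpace X] {μ : Measure X}
    (hm : IsYoungDensity m) {w : X → ℝ} (hw : MemOrlicz (youngFn m) μ w) {S : Set X}
    (hS : μ S < ∞) : IntegrableOn w S μ := by
  obtain ⟨k, hk, hi⟩ := hw.integrable_modular hm.isYoungLike
  have : IsFiniteMeasure (μ.restrict S) := ⟨by simpa using hS⟩
  have h1 : Integrable (fun x => k * (1 + youngFn m (w x / k) / youngFn m 1)) (μ.restrict S) :=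
    ((integrable_const 1).add (hi.restrict.div_const _)).const_mul k
  refine h1.mono' hw.1.restrict.aestronglyMeasurable (ae_of_all _ fun x => ?_)
  have := hm.isYoungLike.abs_le (hm.youngFn_pos one_pos) (w x / k)
  rw [abs_div, abs_of_pos hk, div_le_iff₀ hk] at this
  rw [Real.norm_eq_abs]
  linarith

theorem MemOrlicz.integrable_of_bounded_support (hm : IsYoungDensity m) {w : Rn n → ℝ}
    (hw : MemOrlicz (youngFn m) volume w) {K : Set (Rn n)} (hK : Bornology.IsBounded K)
    (h0 : ∀ x, x ∉ K → w x = 0) : Integrable w :=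
  (integrableOn_iff_integrable_of_support_subset fun x hx => by
    by_contra h; exact hx (h0 x h)).1 (hw.integrableOn hm hK.measure_lt_top)

/-- The integrability needed to apply Fubini's theorem to mollifications. -/
theorem integrable_prod_translate {X : Type*} [MeasurableSpace X] {μ : Measure X} [SFinite μ]
    (hm : IsYoungDensity m) {G F : X → ℝ} (hG : MemOrlicz (complementaryFn (youngFn m)) μ G)
    (hF : MemOrlicz (youngFn m) μ F) (hFm : Measurable F) {T : Rn n → X → X}
    (hT : ∀ z, MeasurePreserving (T z) μ μ) (hTm : Measurable fun q : X × Rn n => T q.2 q.1)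
    {ρ : Rn n → ℝ} (hρ : Integrable ρ) :
    Integrable (fun q : X × Rn n => ρ q.2 * (G q.1 * F (T q.2 q.1))) (μ.prod volume) := by
  obtain ⟨k, hk, hGi⟩ := hG.integrable_modular hm.isYoungLike_complementary
  obtain ⟨l, hl, hFi⟩ := hF.integrable_modular hm.isYoungLike
  have hmeas : AEStronglyMeasurable
      (fun q : X × Rn n => ρ q.2 * (G q.1 * F (T q.2 q.1))) (μ.prod volume) := by
    refine AEStronglyMeasurable.mul ?_ (AEStronglyMeasurable.mul ?_ ?_)
    · exact hρ.1.comp_quasiMeasurePreserving Measure.quasiMeasurePreserving_snd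
    · exact (hG.1.comp_quasiMeasurePreserving
        Measure.quasiMeasurePreserving_fst).aestronglyMeasurable
    · exact (hFm.comp hTm).aestronglyMeasurable
  have hint : ∀ z, ∫ x, youngFn m (F (T z x) / l) ∂μ = ∫ x, youngFn m (F x / l) ∂μ := by
    intro j
    have h1 := (hT j).map_eq
    conv_rhs => rw [← h1]
    rw [integral_map (hT j).measurable.aemeasurable (by rw [h1]; exact hFi.1)]
  have hFT : ∀ z, Integrable (fun x => youngFn m (F (T z x) / l)) μ := fun z =>
    (hT z).integrable_comp_of_integrable (g := fun x => youngFn m (F x / l)) hFi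
  have hsec : ∀ z, Integrable (fun x => G x * F (T z x)) μ := fun z =>
    hG.integrable_mul hm (hF.comp hm.isYoungLike (hT z))
  rw [integrable_prod_iff' hmeas]
  refine ⟨ae_of_all _ fun z => (hsec z).const_mul (ρ z), ?_⟩
  -- Young's inequality bounds `∫ |G (F ∘ T_z)|` independently of `z`, since `T_z` preserves the
  -- modular of `F`; integrability of `ρ` does the rest.
  refine (hρ.norm.mul_const ((k * l) * (∫ x, complementaryFn (youngFn m) (G x / k) ∂μ +
    ∫ x, youngFn m (F x / l) ∂μ))).mono' hmeas.norm.prod_swap.integral_prod_right'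
    (ae_of_all _ fun z => ?_)
  rw [Real.norm_of_nonneg (integral_nonneg fun _ => norm_nonneg _)]
  simp only [norm_mul (ρ z)]
  rw [integral_const_mul]
  gcongr
  rw [← hint z, ← integral_add hGi (hFT z), ← integral_const_mul]
  refine integral_mono (hsec z).norm ((hGi.add (hFT z)).const_mul _) fun x => ?_
  have h := hm.young (G x / k) (F (T z x) / l)
  have e : G x * F (T z x) = (k * l) * (G x / k * (F (T z x) / l)) := by field_simp
  rw [Real.norm_eq_abs, e, abs_mul, abs_of_pos (mul_pos hk hl)]
  exact mul_le_mul_of_nonneg_left h (by positivity)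

theorem integral_mul_integral_swap {X : Type*} [MeasurableSpace X] {μ : Measure X} [SFinite μ]
    (hm : IsYoungDensity m) {G F : X → ℝ} (hG : MemOrlicz (complementaryFn (youngFn m)) μ G)
    (hF : MemOrlicz (youngFn m) μ F) (hFm : Measurable F) {T : Rn n → X → X}
    (hT : ∀ z, MeasurePreserving (T z) μ μ) (hTm : Measurable fun q : X × Rn n => T q.2 q.1)
    {ρ : Rn n → ℝ} (hρ : Integrable ρ) :
    ∫ x, G x * (∫ z, ρ z * F (T z x)) ∂μ = ∫ z, ρ z * (∫ x, G x * F (T z x) ∂μ) := by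
  have h := integral_integral_swap (f := fun x z => ρ z * (G x * F (T z x)))
    (integrable_prod_translate hm hG hF hFm hT hTm hρ)
  simp only [← integral_const_mul]
  rw [← h]
  refine integral_congr_ae (ae_of_all _ fun x => ?_)
  refine integral_congr_ae (ae_of_all _ fun z => ?_)
  simp only
  ring

/-- Both the Hölder quotient and the pairing are linear and `Dˢ` commutes with simultaneous
translation, so Fubini's theorem moves the average over `z` outside. Thus a mollification can be
tested through translates of `w`. -/
theorem pairing_convolution (hm : IsYoungDensity m) {g : Rn n → ℝ} {G : Rn n × Rn n → ℝ}
    (hg : MemOrlicz (complementaryFn (youngFn m)) volume g)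
    (hG : MemOrlicz (complementaryFn (youngFn m)) (nuMeasure n) G) {w : Rn n → ℝ}
    (hw : MemWL (youngFn m) s w) (hwm : Measurable w) (hwi : Integrable w) {ρ : Rn n → ℝ}
    (hρ : Continuous ρ) (hρc : HasCompactSupport ρ) :
    pairing s g G (convolution ρ w (ContinuousLinearMap.lsmul ℝ ℝ) volume) =
      ∫ z, ρ z * pairing s g G (fun x => w (x - z)) := by
  have hρi : Integrable ρ := hρ.integrable_of_hasCompactSupport hρc
  have hex : ∀ x, Integrable (fun z => ρ z * w (x - z)) := fun x => by
    obtain ⟨B, hB⟩ := hρ.bounded_above_of_compact_support hρc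
    exact (hwi.comp_sub_left x).bdd_mul hρ.aestronglyMeasurable (ae_of_all _ hB)
  have hmp : ∀ z : Rn n, MeasurePreserving (fun x => x - z) volume volume :=
    fun z => measurePreserving_sub_right volume z
  have hmp2 : ∀ z : Rn n, MeasurePreserving (fun p : Rn n × Rn n => (p.1 - z, p.2 - z))
      (nuMeasure n) (nuMeasure n) := fun z => by
    simpa [sub_eq_add_neg] using measurePreserving_nu_shift (-z)
  have hhq : ∀ z p, holderQuot s (fun x => w (x - z)) p = holderQuot s w (p.1 - z, p.2 - z) :=
    fun z p => by simp [holderQuot]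
  have hconv : ∀ p, holderQuot s (convolution ρ w (ContinuousLinearMap.lsmul ℝ ℝ) volume) p =
      ∫ z, ρ z * holderQuot s w (p.1 - z, p.2 - z) := by
    intro p
    simp only [holderQuot, convolution, ContinuousLinearMap.lsmul_apply, smul_eq_mul]
    rw [← integral_sub (hex _) (hex _), ← integral_div]
    refine integral_congr_ae (ae_of_all _ fun z => ?_)
    simp only [sub_sub_sub_cancel_right]
    ring
  unfold pairing
  simp only [hhq, hconv]
  simp only [convolution, ContinuousLinearMap.lsmul_apply, smul_eq_mul, mul_add]
  have hT1 : Measurable fun q : Rn n × Rn n => q.1 - q.2 := by fun_prop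
  have hT2 : Measurable fun q : (Rn n × Rn n) × Rn n => (q.1.1 - q.2, q.1.2 - q.2) := by fun_prop
  have hFm : Measurable (holderQuot s w) := measurable_holderQuot hwm
  rw [integral_mul_integral_swap hm hg hw.1 hwm hmp hT1 hρi,
    integral_mul_integral_swap hm hG hw.2 hFm hmp2 hT2 hρi, ← integral_add]
  · have := (integrable_prod_translate hm hg hw.1 hwm hmp hT1 hρi).integral_prod_right
    simpa [integral_const_mul] using this
  · have := (integrable_prod_translate hm hG hw.2 hFm hmp2 hT2 hρi).integral_prod_right
    simpa [integral_const_mul] using this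

variable {Ω : Opens (Rn n)}

/-- A pairing that vanishes on `𝓓(Ω)` vanishes on functions with compact support in `Ω`. -/
theorem pairing_eq_zero_of_compact_support (hm : IsYoungDensity m) {g : Rn n → ℝ}
    {G : Rn n × Rn n → ℝ}
    (hg : MemOrlicz (complementaryFn (youngFn m)) volume g)
    (hG : MemOrlicz (complementaryFn (youngFn m)) (nuMeasure n) G)
    (h0 : ∀ φ : 𝓓(Ω, ℝ), pairing s g G φ = 0) {w : Rn n → ℝ}
    (hw : MemWL (youngFn m) s w) (hwm : Measurable w) {K : Set (Rn n)} (hK : IsCompact K)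
    (hKΩ : K ⊆ Ω) (hwK : ∀ x, x ∉ K → w x = 0) : pairing s g G w = 0 := by
  have hwi : Integrable w := hw.1.integrable_of_bounded_support hm hK.isBounded hwK
  obtain ⟨δ₀, hδ₀, hthick⟩ := hK.exists_cthickening_subset_open Ω.isOpen hKΩ
  have hcont := continuous_pairing_shift (s := s) hm hg hG hw hwi
  refine eq_of_forall_dist_le fun ε hε => ?_
  obtain ⟨δ₁, hδ₁, hδε⟩ := Metric.continuousAt_iff.1 (hcont.continuousAt (x := 0)) ε hε
  -- `δ₀` keeps the mollification supported in `Ω`; `δ₁` makes the pairings with translates by less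
  -- than `δ` differ from `pairing s g G w` by less than `ε`.
  set δ := min δ₀ δ₁
  have hδ : 0 < δ := lt_min hδ₀ hδ₁
  let ρ : ContDiffBump (0 : Rn n) := ⟨δ / 2, δ, by positivity, by linarith⟩
  have hρc : HasCompactSupport (ρ.normed volume) := ρ.hasCompactSupport_normed
  have hρd : ContDiff ℝ ((⊤ : ℕ∞) : WithTop ℕ∞) (ρ.normed volume) := ρ.contDiff_normed
  set φ := convolution (ρ.normed volume) w (ContinuousLinearMap.lsmul ℝ ℝ) volume with hφ
  have hφd : ContDiff ℝ ((⊤ : ℕ∞) : WithTop ℕ∞) φ :=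
    hρc.contDiff_convolution_left _ hρd hwi.locallyIntegrable
  have hsupp : Function.support φ ⊆ Metric.cthickening δ K := by
    intro x hx
    by_contra hcon
    refine hx ?_
    rw [hφ, convolution]
    refine integral_eq_zero_of_ae (ae_of_all _ fun t => ?_)
    simp only [ContinuousLinearMap.lsmul_apply, smul_eq_mul, Pi.zero_apply]
    by_contra hne
    have h1 : t ∈ Function.support (ρ.normed volume) := left_ne_zero_of_mul hne
    rw [ρ.support_normed_eq] at h1
    have h2 : x - t ∈ K := by
      by_contra h; exact right_ne_zero_of_mul hne (hwK _ h)
    refine hcon (Metric.mem_cthickening_of_dist_le x (x - t) δ K h2 ?_)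
    have : ‖t‖ < δ := by simpa [ρ] using h1
    rw [dist_eq_norm]
    simpa using this.le
  have htsupp : tsupport φ ⊆ Metric.cthickening δ K :=
    closure_minimal hsupp Metric.isClosed_cthickening
  have hcs : HasCompactSupport φ :=
    HasCompactSupport.of_support_subset_isCompact (hK.cthickening) hsupp
  let Φ : 𝓓(Ω, ℝ) := ⟨φ, hφd, hcs,
    htsupp.trans ((Metric.cthickening_mono (min_le_left _ _) K).trans hthick)⟩
  have hΦ : pairing s g G φ = 0 := h0 Φ
  -- The vanishing pairing with the test function is an average of the pairings with nearby
  -- translates, hence it is within `ε` of `pairing s g G w`.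
  rw [hφ, pairing_convolution hm hg hG hw hwm hwi ρ.continuous_normed hρc] at hΦ
  have hd := ρ.dist_normed_convolution_le (μ := volume) (x₀ := 0) (ε := ε)
    (g := fun a => pairing s g G fun x => w (x + a)) hcont.aestronglyMeasurable
    (fun z hz => (hδε (lt_of_lt_of_le hz (min_le_right _ _))).le)
  have e : (convolution (ρ.normed volume) (fun a => pairing s g G fun x => w (x + a))
      (ContinuousLinearMap.lsmul ℝ ℝ) volume) 0 = 0 := by
    rw [convolution, ← hΦ]
    refine integral_congr_ae (ae_of_all _ fun z => ?_)
    simp [sub_eq_add_neg]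
  rw [e] at hd
  simpa [dist_comm] using hd

end Pairing

/-! ### Vanishing outside the domain, and independence of the representation -/

section Independence

variable {m : ℝ → ℝ} {s : ℝ} {Ω : Opens (Rn n)}

/-- Functions of `W₀ˢL_M(Ω)` vanish a.e. outside `Ω`. -/
theorem MemW0L.ae_eq_zero (hm : IsYoungDensity m) {v : Rn n → ℝ} (hv : MemW0L m s Ω v) :
    ∀ᵐ x, x ∉ Ω → v x = 0 := by
  have hB := hm.isYoungLike_complementary
  set v' := hv.1.1.1.mk v
  have hv'm : Measurable v' := hv.1.1.1.measurable_mk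
  have hv' : v =ᵐ[volume] v' := hv.1.1.1.ae_eq_mk
  have key : ∀ R : ℕ, ∀ᵐ x, x ∈ Metric.ball (0 : Rn n) R \ Ω → v x = 0 := by
    intro R
    set S : Set (Rn n) := Metric.ball (0 : Rn n) R \ Ω
    have hSm : MeasurableSet S := measurableSet_ball.diff Ω.isOpen.measurableSet
    have hSb : Bornology.IsBounded S := Metric.isBounded_ball.subset sdiff_subset
    -- Testing with the sign of `v` on a bounded part of the complement: the pairing is `∫_S |v|`,
    -- and it is 0 on the weak closure because it is 0 on `𝓓(Ω)`.
    set g : Rn n → ℝ := S.indicator (fun x => if 0 ≤ v' x then 1 else -1)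
    have hgm : Measurable g :=
      (Measurable.ite (measurableSet_le measurable_const hv'm) measurable_const
        measurable_const).indicator hSm
    have hg : MemOrliczE (complementaryFn (youngFn m)) volume g := by
      refine memOrliczE_of_bounded hB hgm (C := 1) (fun x => ?_)
        (hSb.subset support_indicator_subset)
        ((measure_mono support_indicator_subset).trans_lt hSb.measure_lt_top)
      by_cases hx : x ∈ S
      · simp only [g, indicator_of_mem hx]; split_ifs <;> simp
      · simp [g, indicator_of_notMem hx]
    let q : {q : (Rn n → ℝ) × (Rn n × Rn n → ℝ) //
      MemOrliczE (complementaryFn (youngFn m)) volume q.1 ∧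
        MemOrliczE (complementaryFn (youngFn m)) (nuMeasure n) q.2} :=
      ⟨(g, fun _ => 0), hg, memOrliczE_zero hB⟩
    have hcl : IsClosed {F : {q : (Rn n → ℝ) × (Rn n × Rn n → ℝ) //
      MemOrliczE (complementaryFn (youngFn m)) volume q.1 ∧
        MemOrliczE (complementaryFn (youngFn m)) (nuMeasure n) q.2} → ℝ | F q = 0} :=
      isClosed_eq (continuous_apply q) continuous_const
    have hzero : ∫ x, g x * v x = 0 := by
      have := closure_minimal (t := {F | F q = 0}) ?_ hcl hv.2
      · simpa [weakCoord, pairing, q] using this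
      · rintro _ ⟨φ, rfl⟩
        simp only [mem_ofPred_eq, weakCoord, pairing, q, zero_mul, integral_zero, add_zero]
        refine integral_eq_zero_of_ae (ae_of_all _ fun x => ?_)
        by_cases hx : x ∈ S
        · have : φ x = 0 := image_eq_zero_of_notMem_tsupport fun h => hx.2 (φ.tsupport_subset h)
          simp [this]
        · simp [g, indicator_of_notMem hx]
    have habs : (fun x => g x * v x) =ᵐ[volume] S.indicator fun x => |v x| := by
      filter_upwards [hv'] with x hx
      by_cases hxS : x ∈ S
      · simp only [g, indicator_of_mem hxS, ← hx]
        split_ifs with h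
        · rw [abs_of_nonneg h, one_mul]
        · rw [abs_of_neg (not_le.1 h)]; ring
      · simp [g, indicator_of_notMem hxS]
    rw [integral_congr_ae habs, integral_eq_zero_iff_of_nonneg
      (fun x => indicator_nonneg (fun _ _ => abs_nonneg _) x)
      ((integrable_indicator_iff hSm).2 (hv.1.1.integrableOn hm hSb.measure_lt_top).abs)] at hzero
    filter_upwards [hzero] with x hx hxS
    simpa [indicator_of_mem hxS] using hx
  filter_upwards [ae_all_iff.2 key] with x hx hxΩ
  obtain ⟨R, hR⟩ := exists_nat_gt ‖x‖
  exact hx R ⟨by simpa using hR, hxΩ⟩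

/-- A pairing that vanishes on `𝓓(Ω)` vanishes on functions whose support lies in a part of
`closure Ω` that can be translated into `Ω`. -/
theorem pairing_eq_zero_of_translate (hm : IsYoungDensity m) {g : Rn n → ℝ}
    {G : Rn n × Rn n → ℝ}
    (hg : MemOrlicz (complementaryFn (youngFn m)) volume g)
    (hG : MemOrlicz (complementaryFn (youngFn m)) (nuMeasure n) G)
    (h0 : ∀ φ : 𝓓(Ω, ℝ), pairing s g G φ = 0) {w : Rn n → ℝ}
    (hw : MemWL (youngFn m) s w) (hwm : Measurable w) {K : Set (Rn n)} (hK : IsCompact K)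
    (hwK : ∀ x, x ∉ K → w x = 0) {e : Rn n} {t₀ : ℝ} (ht₀ : 0 < t₀)
    (hKΩ : ∀ x ∈ K, ∀ t : ℝ, 0 < t → t < t₀ → x + t • e ∈ Ω) : pairing s g G w = 0 := by
  have hwi : Integrable w := hw.1.integrable_of_bounded_support hm hK.isBounded hwK
  have hlim := tendsto_pairing_shift (s := s) hm hg hG hw hwi
  -- The sign is negative because `x ↦ w(x - t e)` is supported in `K + t e`, which lies in `Ω`.
  have h2 : Tendsto (fun t : ℝ => -(t • e)) (𝓝[>] 0) (𝓝 0) := by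
    have : Tendsto (fun t : ℝ => -(t • e)) (𝓝 0) (𝓝 (-((0 : ℝ) • e))) :=
      (by fun_prop : Continuous fun t : ℝ => -(t • e)).tendsto 0
    simp only [zero_smul, neg_zero] at this
    exact this.mono_left nhdsWithin_le_nhds
  refine tendsto_nhds_unique (hlim.comp h2) (tendsto_const_nhds.congr' ?_)
  filter_upwards [Ioo_mem_nhdsGT ht₀] with t ht
  symm
  refine pairing_eq_zero_of_compact_support hm hg hG h0 (hw.shift hm.isYoungLike _)
    (hwm.comp (measurable_add_const _)) (K := (fun x => x + t • e) '' K)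
    (hK.image (by fun_prop)) ?_ ?_
  · rintro _ ⟨x, hx, rfl⟩
    exact hKΩ x hx t ht.1 ht.2
  · intro x hx
    refine hwK _ fun h => hx ⟨_, h, by simp⟩

/-- A pairing that vanishes on `𝓓(Ω)` vanishes on `W₀ˢL_M(Ω)` if `Ω` is bounded and has the segment
property. -/
theorem pairing_eq_zero (hn : 0 < n) (hs0 : 0 < s) (hs1 : s < 1) (hm : IsYoungDensity m)
    (hΩb : Bornology.IsBounded (Ω : Set (Rn n))) (hΩs : SegmentProperty (Ω : Set (Rn n)))
    {g : Rn n → ℝ} {G : Rn n × Rn n → ℝ}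
    (hg : MemOrlicz (complementaryFn (youngFn m)) volume g)
    (hG : MemOrlicz (complementaryFn (youngFn m)) (nuMeasure n) G)
    (h0 : ∀ φ : 𝓓(Ω, ℝ), pairing s g G φ = 0) {v : Rn n → ℝ} (hv : MemW0L m s Ω v) :
    pairing s g G v = 0 := by
  have hM := hm.isYoungLike
  obtain ⟨ι, c, e, r, t₀, hr, ht₀, -, -, -, -, hcov, hseg⟩ := hΩs
  have hcl : IsCompact (closure (Ω : Set (Rn n))) := hΩb.isCompact_closure
  have hfr : IsCompact (frontier (Ω : Set (Rn n))) :=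
    hcl.of_isClosed_subset isClosed_frontier frontier_subset_closure
  have hloc : ∀ x : Rn n, ∃ ρ : ℝ, 0 < ρ ∧ (x ∈ frontier (Ω : Set (Rn n)) →
      ∃ j, Metric.closedBall x ρ ⊆ Metric.ball (c j) r) := by
    intro x
    by_cases hx : x ∈ frontier (Ω : Set (Rn n))
    · obtain ⟨j, hj⟩ := mem_iUnion.1 (hcov hx)
      obtain ⟨ρ, hρ, hsub⟩ := Metric.nhds_basis_closedBall.mem_iff.1
        (Metric.isOpen_ball.mem_nhds hj)
      exact ⟨ρ, hρ, fun _ => ⟨j, hsub⟩⟩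
    · exact ⟨1, one_pos, fun h => absurd h hx⟩
  choose ρ hρ hρs using hloc
  let η : ∀ x : Rn n, ContDiffBump x := fun x => ⟨ρ x / 2, ρ x, by have := hρ x; positivity,
    by have := hρ x; linarith⟩
  have hηd : ∀ x, ContDiff ℝ 1 (η x) := fun x => (η x).contDiff
  -- The half balls, where the bumps equal 1, already cover the boundary. Multiplying successively
  -- by the factors `1 - η x` therefore makes the function vanish near `∂Ω`.
  obtain ⟨T, hTf, hT⟩ := hfr.elim_nhds_subcover (fun x => Metric.ball x (ρ x / 2))
    (fun x _ => Metric.ball_mem_nhds x (by have := hρ x; positivity))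
  have step : ∀ x ∈ frontier (Ω : Set (Rn n)), ∀ w : Rn n → ℝ, Measurable w →
      MemWL (youngFn m) s w → (∀ y, y ∉ Ω → w y = 0) →
      (MemWL (youngFn m) s fun y => (1 - η x y) * w y) ∧
        pairing s g G w = pairing s g G fun y => (1 - η x y) * w y := by
    intro x hx w hwm hw hw0
    obtain ⟨L, hL, hB, hC⟩ := exists_lipschitz_of_contDiff (hηd x) (η x).hasCompactSupport
    have hηm : Measurable (η x) := (hηd x).continuous.measurable
    have h1 := hw.mul_lipschitz hn hs0 hs1 hM hηm hL hB hC
    have h2 : MemWL (youngFn m) s fun y => (1 - η x y) * w y := by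
      refine hw.mul_lipschitz (η := fun y => 1 - η x y) hn hs0 hs1 hM (measurable_const.sub hηm)
        (L := L) (C := 1)
        (fun a b => ?_) (fun a b => ?_) (fun a => ?_)
      · rw [sub_sub_sub_cancel_left, abs_sub_comm]; exact hL a b
      · rw [sub_sub_sub_cancel_left, abs_sub_comm]; exact hB a b
      · have := (η x).nonneg (x := a)
        have := (η x).le_one (x := a)
        rw [abs_le]; constructor <;> linarith
    refine ⟨h2, ?_⟩
    -- The piece `η x · w` lives in `closure Ω` inside one ball of the segment property, so its
    -- pairing vanishes and only the other piece survives.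
    have e : w = fun y => η x y * w y + (1 - η x y) * w y := by ext y; ring
    conv_lhs => rw [e]
    rw [pairing_add hm hg hG h1 h2]
    obtain ⟨j, hj⟩ := hρs x hx
    rw [pairing_eq_zero_of_translate hm hg hG h0 h1 (hηm.mul hwm)
      (K := closure (Ω : Set (Rn n)) ∩ Metric.closedBall x (ρ x))
      (hcl.inter_right Metric.isClosed_closedBall) ?_ ht₀
      (fun y hy t ht1 ht2 => hseg j y ⟨hy.1, hj hy.2⟩ t ht1 ht2), zero_add]
    intro y hy
    by_cases hyΩ : y ∈ Ω
    · have : y ∉ Metric.closedBall x (ρ x) := fun h => hy ⟨subset_closure hyΩ, h⟩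
      rw [(η x).zero_of_le_dist (by simpa [η] using (not_le.1 this).le), zero_mul]
    · rw [hw0 y hyΩ, mul_zero]
  -- The support conditions above are pointwise, so `v` is replaced by a measurable representative
  -- that vanishes everywhere off `Ω`.
  set v' := (Ω : Set (Rn n)).indicator (hv.1.1.1.mk v)
  have hv'm : Measurable v' := hv.1.1.1.measurable_mk.indicator Ω.isOpen.measurableSet
  have hvv' : v =ᵐ[volume] v' := by
    filter_upwards [hv.1.1.1.ae_eq_mk, hv.ae_eq_zero hm] with x h1 h2
    by_cases hx : x ∈ (Ω : Set (Rn n))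
    · simp [v', indicator_of_mem hx, h1]
    · simp [v', indicator_of_notMem hx, h2 hx]
  have hv'0 : ∀ y, y ∉ Ω → v' y = 0 := fun y hy => indicator_of_notMem (s := (Ω : Set (Rn n))) hy _
  have hv'W : MemWL (youngFn m) s v' := hv.1.congr hvv'.symm
  have hprod : ∀ T' : Finset (Rn n), T' ⊆ T →
      ∃ w : Rn n → ℝ, Measurable w ∧ MemWL (youngFn m) s w ∧ (∀ y, y ∉ Ω → w y = 0) ∧
        (∀ x ∈ T', ∀ y ∈ Metric.ball x (ρ x / 2), w y = 0) ∧
        pairing s g G v' = pairing s g G w := by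
    classical
    intro T'
    induction T' using Finset.induction_on with
    | empty => exact fun _ => ⟨v', hv'm, hv'W, hv'0, by simp, rfl⟩
    | insert x T' _ ih =>
      intro hsub
      obtain ⟨w, hwm, hw, hw0, hwT, hwp⟩ := ih ((Finset.subset_insert _ _).trans hsub)
      obtain ⟨h1, h2⟩ := step x (hTf x (hsub (Finset.mem_insert_self _ _))) w hwm hw hw0
      refine ⟨_, (measurable_const.sub (hηd x).continuous.measurable).mul hwm, h1,
        fun y hy => ?_, fun z hz y hy => ?_, hwp.trans h2⟩
      · simp [hw0 y hy]
      · rcases Finset.mem_insert.1 hz with rfl | hz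
        · simp only [Pi.sub_apply, Pi.mul_apply]
          rw [(η z).one_of_mem_closedBall (Metric.ball_subset_closedBall hy)]; simp
        · simp [hwT z hz y hy]
  obtain ⟨w, hwm, hw, hw0, hwT, hwp⟩ := hprod T subset_rfl
  rw [pairing_congr hvv', hwp]
  refine pairing_eq_zero_of_compact_support hm hg hG h0 hw hwm
    (K := closure (Ω : Set (Rn n)) \ ⋃ x ∈ T, Metric.ball x (ρ x / 2))
    (hcl.diff (isOpen_biUnion fun _ _ => Metric.isOpen_ball)) ?_ ?_
  · rintro x ⟨hx1, hx2⟩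
    by_contra hx
    refine hx2 (hT ?_)
    rw [Ω.isOpen.frontier_eq]
    exact ⟨hx1, hx⟩
  · intro x hx
    by_cases hxΩ : x ∈ Ω
    · have : x ∈ ⋃ x ∈ T, Metric.ball x (ρ x / 2) := by
        by_contra h; exact hx ⟨subset_closure hxΩ, h⟩
      obtain ⟨z, hz, hxz⟩ := mem_iUnion₂.1 this
      exact hwT z hz x hxz
    · exact hw0 x hxΩ

/-- The duality does not depend on the representation of the distribution. -/
theorem dualPair_eq (hn : 0 < n) (hs0 : 0 < s) (hs1 : s < 1) (hm : IsYoungDensity m)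
    (hΩb : Bornology.IsBounded (Ω : Set (Rn n))) (hΩs : SegmentProperty (Ω : Set (Rn n)))
    {g : Rn n → ℝ} {G : Rn n × Rn n → ℝ} {T : 𝓓(Ω, ℝ) → ℝ}
    (hg : MemOrlicz (complementaryFn (youngFn m)) volume g)
    (hG : MemOrlicz (complementaryFn (youngFn m)) (nuMeasure n) G)
    (hT : ∀ φ : 𝓓(Ω, ℝ), T φ = pairing s g G φ) {v : Rn n → ℝ} (hv : MemW0L m s Ω v) :
    dualPair m s Ω T v = pairing s g G v := by
  have h : MemNegL m s Ω T := ⟨g, G, hg, hG, hT⟩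
  rw [dualPair, dif_pos h]
  obtain ⟨hg', hG', hT'⟩ := h.choose_spec.choose_spec
  have hB := hm.isYoungLike_complementary
  -- The difference of two representations of `T` is a pairing that vanishes on `𝓓(Ω)`.
  have := pairing_eq_zero hn hs0 hs1 hm hΩb hΩs (hg'.sub hB hg) (hG'.sub hB hG) (fun φ => by
    rw [pairing_sub_left hm hg' hG' hg hG (memWL_test hn hs0 hs1 hm.isYoungLike φ), ← hT', ← hT,
      sub_self]) hv
  rw [pairing_sub_left hm hg' hG' hg hG hv.1] at this
  linarith

theorem dualPair_test {T : 𝓓(Ω, ℝ) → ℝ} (hT : MemNegL m s Ω T) (φ : 𝓓(Ω, ℝ)) :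
    dualPair m s Ω T φ = T φ := by
  rw [dualPair, dif_pos hT, hT.choose_spec.choose_spec.2.2]

end Independence

/-! ## Level sets of Hölder quotients -/

section LevelSets

variable {s : ℝ}

/-- A set on which a function is constant and differentiable with nonzero derivative is null. -/
theorem volume_eq_zero_of_fderiv_ne_zero {f : Rn n → ℝ} {f' : Rn n → Rn n →L[ℝ] ℝ} {S : Set (Rn n)}
    {c : ℝ} (hS : MeasurableSet S) (hc : ∀ x ∈ S, f x = c) (hf : ∀ x ∈ S, HasFDerivAt f (f' x) x)
    (hf' : ∀ x ∈ S, f' x ≠ 0) : volume S = 0 := by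
  by_cases htriv : ∃ e : Rn n, e ≠ 0
  · obtain ⟨e, he⟩ := htriv
    -- On `S` the map is constant, so 0 approximates it with error 0, and the derivative must be 0
    -- at almost every point of `S`. The factor `e` only makes it a self-map of `ℝⁿ`.
    have happ : ApproximatesLinearOn (fun y => f y • e) (0 : Rn n →L[ℝ] Rn n) S 0 := by
      intro x hx y hy
      simp [hc x hx, hc y hy]
    have h := happ.norm_fderiv_sub_le volume hS (fun x => (f' x).smulRight e)
      (fun x hx => ((hf x hx).smul_const e).hasFDerivWithinAt)
    have h2 : ∀ᵐ x ∂(volume.restrict S), False := by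
      filter_upwards [h, ae_restrict_mem hS] with x hx hxS
      refine hf' x hxS ?_
      have h3 : (f' x).smulRight e = 0 := by
        rw [sub_zero] at hx
        exact nnnorm_eq_zero.1 (le_antisymm hx bot_le)
      ext v
      have h4 : f' x v • e = 0 := by
        simpa using congrArg (fun l : Rn n →L[ℝ] Rn n => l v) h3
      simpa [he] using h4
    have h3 : volume.restrict S = 0 := by
      have := ae_iff.1 h2
      simpa using this
    simpa using h3
  · push Not at htriv
    have : S = ∅ := by
      refine eq_empty_of_forall_notMem fun x hx => hf' x hx ?_
      ext v
      rw [htriv v]; simp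
    simp [this]

theorem hasFDerivAt_norm_sub_rpow {x y : Rn n} (h : x ≠ y) :
    HasFDerivAt (fun y => ‖x - y‖ ^ s)
      (-(s * ‖x - y‖ ^ (s - 2)) • innerSL ℝ (x - y)) y := by
  have h0 : 0 < ‖x - y‖ := norm_pos_iff.2 (sub_ne_zero.2 h)
  have h1 : HasFDerivAt (fun y => x - y) (-ContinuousLinearMap.id ℝ (Rn n)) y :=
    (hasFDerivAt_id y).const_sub x
  have h2 := (h1.norm_sq).rpow_const (p := s / 2) (Or.inl (by positivity))
  have e : (fun y => ‖x - y‖ ^ s) = fun y => (‖x - y‖ ^ 2) ^ (s / 2) := by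
    ext y
    rw [← Real.rpow_natCast, ← Real.rpow_mul (norm_nonneg _)]
    congr 1; push_cast; ring
  rw [e]
  refine h2.congr_fderiv (ContinuousLinearMap.ext fun v => ?_)
  have e2 : (‖x - y‖ ^ 2) ^ (s / 2 - 1) = ‖x - y‖ ^ (s - 2) := by
    rw [← Real.rpow_natCast, ← Real.rpow_mul (norm_nonneg _)]
    congr 1; push_cast; ring
  rw [e2]
  simp
  ring

/-- A zero of the gradient would force `|a|^{s-2} a = |b|^{s-2} b` with `a = x₁ - y`, `b = x₂ - y`.
Taking norms gives `|a| = |b|` since `s ≠ 1`, and then `a = b`, which contradicts `x₁ ≠ x₂`. -/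
theorem volume_level_norm_rpow_sub (hn : 0 < n) (hs0 : 0 < s) (hs1 : s < 1) {x₁ x₂ : Rn n}
    (hx : x₁ ≠ x₂) (c : ℝ) : volume {y | ‖x₁ - y‖ ^ s - ‖x₂ - y‖ ^ s = c} = 0 := by
  have : Nonempty (Fin n) := ⟨⟨0, hn⟩⟩
  have hmeas : Measurable fun y : Rn n => ‖x₁ - y‖ ^ s - ‖x₂ - y‖ ^ s := by fun_prop
  set S := {y | ‖x₁ - y‖ ^ s - ‖x₂ - y‖ ^ s = c}
  have hS : MeasurableSet S := hmeas (measurableSet_singleton c)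
  have h : volume (S \ {x₁, x₂}) = 0 := by
    refine volume_eq_zero_of_fderiv_ne_zero
      (f' := fun y => -(s * ‖x₁ - y‖ ^ (s - 2)) • innerSL ℝ (x₁ - y) -
        -(s * ‖x₂ - y‖ ^ (s - 2)) • innerSL ℝ (x₂ - y))
      (hS.diff (by measurability)) (fun y hy => hy.1) (fun y hy => ?_) (fun y hy hzero => ?_)
    · have h1 : x₁ ≠ y := fun h => hy.2 (by simp [h])
      have h2 : x₂ ≠ y := fun h => hy.2 (by simp [h])
      exact (hasFDerivAt_norm_sub_rpow h1).sub (hasFDerivAt_norm_sub_rpow h2)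
    · have h1 : 0 < ‖x₁ - y‖ := norm_pos_iff.2 (sub_ne_zero.2 fun h => hy.2 (by simp [h]))
      have h2 : 0 < ‖x₂ - y‖ := norm_pos_iff.2 (sub_ne_zero.2 fun h => hy.2 (by simp [h]))
      have h3 : ‖x₁ - y‖ ^ (s - 2) • (x₁ - y) = ‖x₂ - y‖ ^ (s - 2) • (x₂ - y) := by
        refine ext_inner_right ℝ fun v => ?_
        have h4 := congrArg (fun l : Rn n →L[ℝ] ℝ => l v) hzero
        simp only [sub_apply, smul_apply,
          innerSL_apply_apply, smul_eq_mul, zero_apply] at h4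
        rw [real_inner_smul_left, real_inner_smul_left]
        have h5 : s * (‖x₁ - y‖ ^ (s - 2) * inner ℝ (x₁ - y) v) =
            s * (‖x₂ - y‖ ^ (s - 2) * inner ℝ (x₂ - y) v) := by linarith
        exact mul_left_cancel₀ hs0.ne' h5
      have hnorm : ∀ {z : Rn n}, 0 < ‖z‖ → ‖‖z‖ ^ (s - 2) • z‖ = ‖z‖ ^ (s - 1) := by
        intro z hz
        rw [norm_smul, Real.norm_of_nonneg (by positivity)]
        nth_rewrite 2 [← Real.rpow_one ‖z‖]
        rw [← Real.rpow_add hz]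
        congr 1; ring
      have h4 : ‖x₁ - y‖ ^ (s - 1) = ‖x₂ - y‖ ^ (s - 1) := by
        rw [← hnorm h1, ← hnorm h2, h3]
      have h5 : ‖x₁ - y‖ = ‖x₂ - y‖ :=
        Real.rpow_left_injOn (by linarith : s - 1 ≠ 0) (norm_nonneg _) (norm_nonneg _) h4
      rw [h5] at h3
      have h6 := smul_right_injective _ (by positivity : ‖x₂ - y‖ ^ (s - 2) ≠ 0) h3
      exact hx (sub_left_injective h6)
  have hfin : volume ({x₁, x₂} : Set (Rn n)) = 0 := (Set.toFinite _).measure_zero _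
  refine measure_mono_null (t := (S \ {x₁, x₂}) ∪ {x₁, x₂}) (fun y hy => ?_)
    (measure_union_null h hfin)
  by_cases h : y ∈ ({x₁, x₂} : Set (Rn n))
  · exact Or.inr h
  · exact Or.inl ⟨hy, h⟩

/-- The level sets of a Hölder quotient at nonzero levels are null. -/
theorem ae_holderQuot_ne (hn : 0 < n) (hs0 : 0 < s) (hs1 : s < 1) {u : Rn n → ℝ}
    (hu : Measurable u) {c : ℝ} (hc : c ≠ 0) : ∀ᵐ p ∂(nuMeasure n), holderQuot s u p ≠ c := by
  have : Nonempty (Fin n) := ⟨⟨0, hn⟩⟩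
  set E : Set (Rn n × Rn n) := {q | u q.2 - u q.1 = -c * ‖q.2 - q.1‖ ^ s}
  have hE : MeasurableSet E := measurableSet_eq_fun (by fun_prop) (by fun_prop)
  -- Doubling the variable eliminates `u(y)`: subtracting the two equations puts `y` in a level set
  -- of `|x₁ - y|^s - |x₂ - y|^s`, so `Q` is null. Sliced over `y` instead, `Q` is a product `E_y ×
  -- E_y`, whence almost every `E_y` is null.
  set Q : Set ((Rn n × Rn n) × Rn n) := {r | (r.2, r.1.1) ∈ E ∧ (r.2, r.1.2) ∈ E}
  have hQ : MeasurableSet Q := by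
    refine MeasurableSet.inter ?_ ?_
    · exact (measurable_snd.prodMk (measurable_fst.comp measurable_fst)) hE
    · exact (measurable_snd.prodMk (measurable_snd.comp measurable_fst)) hE
  have hdiag : ∀ᵐ r : Rn n × Rn n, r.1 ≠ r.2 := by
    rw [Measure.volume_eq_prod, ae_iff, Measure.measure_prod_null]
    · refine ae_of_all _ fun x => ?_
      have : Prod.mk x ⁻¹' {a : Rn n × Rn n | ¬ a.1 ≠ a.2} = {x} := by
        ext y; simp [eq_comm]
      simp only [this, Pi.zero_apply, measure_singleton]
    · simpa using measurableSet_eq_fun (measurable_fst (α := Rn n) (β := Rn n)) measurable_snd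
  have hQ0 : (volume : Measure ((Rn n × Rn n) × Rn n)) Q = 0 := by
    rw [Measure.volume_eq_prod, Measure.measure_prod_null hQ]
    filter_upwards [hdiag] with r hr
    refine measure_mono_null (fun y hy => ?_)
      (volume_level_norm_rpow_sub hn hs0 hs1 hr (-(u r.1 - u r.2) / c))
    have h1 : u r.1 - u y = -c * ‖r.1 - y‖ ^ s := hy.1
    have h2 : u r.2 - u y = -c * ‖r.2 - y‖ ^ s := hy.2
    show ‖r.1 - y‖ ^ s - ‖r.2 - y‖ ^ s = _
    rw [eq_div_iff hc]
    linarith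
  have hQ1 : (volume : Measure (Rn n × (Rn n × Rn n))) (Prod.swap ⁻¹' Q) = 0 := by
    rw [Measure.volume_eq_prod, Measure.measurePreserving_swap.measure_preimage
      hQ.nullMeasurableSet]
    exact hQ0
  rw [Measure.volume_eq_prod, Measure.measure_prod_null (measurable_swap hQ)] at hQ1
  have hE0 : (volume : Measure (Rn n × Rn n)) E = 0 := by
    rw [Measure.volume_eq_prod, Measure.measure_prod_null hE]
    filter_upwards [hQ1] with y hy
    have e : Prod.mk y ⁻¹' (Prod.swap ⁻¹' Q) = (Prod.mk y ⁻¹' E) ×ˢ (Prod.mk y ⁻¹' E) := rfl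
    rw [e, Pi.zero_apply, Measure.volume_eq_prod, Measure.prod_prod, mul_self_eq_zero] at hy
    exact hy
  refine nuMeasure_absolutelyContinuous.ae_le (mem_ae_iff.2 ?_)
  refine measure_mono_null (fun p hp => ?_) hE0
  have hp : holderQuot s u p = c := by simpa using hp
  unfold holderQuot at hp
  have h0 : ‖p.1 - p.2‖ ^ s ≠ 0 := by
    intro h; rw [h, div_zero] at hp; exact hc hp.symm
  rw [div_eq_iff h0] at hp
  show u p.2 - u p.1 = -c * ‖p.2 - p.1‖ ^ s
  rw [norm_sub_rev]; linarith

/-- Oddness reflects right continuity to the left. The level 0, whose level set may have positive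
measure, is thus never a jump. -/
theorem IsYoungDensity.continuousAt_zero {m : ℝ → ℝ} (hm : IsYoungDensity m) :
    ContinuousAt m 0 := by
  have hr := hm.right_cont 0 le_rfl
  refine continuousAt_iff_continuous_left_right.2 ⟨?_, hr⟩
  have e : m = fun t => - m (-t) := by ext t; rw [hm.odd]; ring
  rw [e]
  refine ContinuousWithinAt.neg ?_
  refine ContinuousWithinAt.comp (t := Ici 0) (by simpa using hr)
    continuous_neg.continuousWithinAt fun t ht => ?_
  simpa using ht

/-- A Young density is continuous at almost every value of a Hölder quotient. -/
theorem ae_continuousAt_holderQuot (hn : 0 < n) (hs0 : 0 < s) (hs1 : s < 1) {m : ℝ → ℝ}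
    (hm : IsYoungDensity m) {u : Rn n → ℝ} (hu : Measurable u) :
    ∀ᵐ p ∂(nuMeasure n), ContinuousAt m (holderQuot s u p) := by
  have h := (ae_ball_iff hm.monotone.countable_not_continuousAt
    (p := fun p c _ => holderQuot s u p ≠ c) (μ := nuMeasure n)).2 fun c hc =>
      ae_holderQuot_ne hn hs0 hs1 hu fun h => hc (h ▸ hm.continuousAt_zero)
  filter_upwards [h] with p hp
  by_contra hcon
  exact hp _ hcon rfl

end LevelSets

/-! ## The fractional `m`-Laplacian in weak form -/

section FracLap

variable {m : ℝ → ℝ} {s : ℝ}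

theorem integral_nuMeasure (f : Rn n × Rn n → ℝ) :
    ∫ p, f p ∂(nuMeasure n) = ∫ p, (1 / ‖p.1 - p.2‖ ^ n) * f p := by
  rw [nuMeasure, integral_withDensity_eq_integral_toReal_smul measurable_nuDensity
    (ae_of_all _ fun _ => ENNReal.ofReal_lt_top)]
  refine integral_congr_ae (ae_of_all _ fun p => ?_)
  simp only [smul_eq_mul]
  rw [ENNReal.toReal_ofReal (by positivity)]

theorem integrable_nuMeasure_iff (f : Rn n × Rn n → ℝ) :
    Integrable f (nuMeasure n) ↔ Integrable fun p => (1 / ‖p.1 - p.2‖ ^ n) * f p := by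
  rw [nuMeasure, integrable_withDensity_iff_integrable_smul' measurable_nuDensity
    (ae_of_all _ fun _ => ENNReal.ofReal_lt_top)]
  refine integrable_congr (ae_of_all _ fun p => ?_)
  simp only [smul_eq_mul]
  rw [ENNReal.toReal_ofReal (by positivity)]

theorem holderQuot_swap (u : Rn n → ℝ) (p : Rn n × Rn n) :
    holderQuot s u p.swap = - holderQuot s u p := by
  simp only [holderQuot, Prod.fst_swap, Prod.snd_swap]
  rw [norm_sub_rev]; ring

variable {Ω : Opens (Rn n)}

/-- For `|z| ≥ ε` the kernel is at least `min(ε, 1) |z|^{-s}`, which is where the constant comes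
from. The truncation makes the two terms of `Dˢφ` separately integrable against `m(Dˢu)`. -/
theorem memOrlicz_truncated_kernel (hn : 0 < n) (hs0 : 0 < s) (hs1 : s < 1) {A : ℝ → ℝ}
    (hA : IsYoungLike A) {φ : Rn n → ℝ} (hφm : Measurable φ) (hφ : MemOrlicz A volume φ)
    {ε : ℝ} (hε : 0 < ε) :
    MemOrlicz A (nuMeasure n) ({p : Rn n × Rn n | ε ≤ ‖p.1 - p.2‖}.indicator fun p =>
      φ p.2 / ‖p.1 - p.2‖ ^ s) := by
  have hS : MeasurableSet {p : Rn n × Rn n | ε ≤ ‖p.1 - p.2‖} :=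
    measurableSet_le measurable_const (measurable_fst.sub measurable_snd).norm
  have hc : 0 < min ε 1 := lt_min hε one_pos
  refine (memOrlicz_kernel_mul (s := s) hn hs0 hs1 hA hφ).of_le_mul hA
    ((by fun_prop : Measurable fun p : Rn n × Rn n =>
      φ p.2 / ‖p.1 - p.2‖ ^ s).indicator hS).aemeasurable (C := (min ε 1)⁻¹)
    (ae_of_all _ fun p => ?_)
  by_cases hp : ε ≤ ‖p.1 - p.2‖
  · rw [indicator_of_mem (show p ∈ {p : Rn n × Rn n | ε ≤ ‖p.1 - p.2‖} from hp)]
    have h0 : 0 < ‖p.1 - p.2‖ := hε.trans_le hp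
    have h1 : min ε 1 * ‖p.1 - p.2‖ ^ (-s) ≤ holderKernel s (p.1 - p.2) := by
      refine le_min ?_ ?_
      · rw [sub_eq_add_neg 1 s, Real.rpow_add h0, Real.rpow_one]
        gcongr
        exact (min_le_left _ _).trans hp
      · exact mul_le_of_le_one_left (by positivity) (min_le_right _ _)
    rw [abs_mul, abs_of_nonneg (holderKernel_nonneg _), ← mul_assoc, abs_div,
      abs_of_nonneg (by positivity : 0 ≤ ‖p.1 - p.2‖ ^ s), div_eq_mul_inv,
      ← Real.rpow_neg h0.le, mul_comm]
    gcongr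
    rwa [inv_mul_eq_div, le_div_iff₀ hc, mul_comm]
  · rw [indicator_of_notMem (show p ∉ {p : Rn n × Rn n | ε ≤ ‖p.1 - p.2‖} from hp), abs_zero]
    positivity

/-- Under the swap of `x` and `y`, `m(Dˢu)` changes sign while the truncated weight does not. The
terms with `φ(x)` and `-φ(y)` hence contribute equally, which accounts for the factor 2 in the
operator. -/
theorem integral_fracLapTrunc (hn : 0 < n) (hs0 : 0 < s) (hs1 : s < 1) (hm : IsYoungDensity m)
    {u : Rn n → ℝ}
    (hu : MemOrlicz (complementaryFn (youngFn m)) (nuMeasure n) fun p => m (holderQuot s u p))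
    {φ : Rn n → ℝ} (hφm : Measurable φ) (hφ : MemOrlicz (youngFn m) volume φ) {ε : ℝ}
    (hε : 0 < ε) :
    ∫ x, fracLapTrunc m s ε u x * φ x =
      ∫ p, {p : Rn n × Rn n | ε ≤ ‖p.1 - p.2‖}.indicator
        (fun p => m (holderQuot s u p) * holderQuot s φ p) p ∂(nuMeasure n) := by
  set S : Set (Rn n × Rn n) := {p | ε ≤ ‖p.1 - p.2‖}
  have hSswap : ∀ p : Rn n × Rn n, p.swap ∈ S ↔ p ∈ S := fun p => by
    simp [S, norm_sub_rev]
  set c : Rn n × Rn n → ℝ := S.indicator fun p => 1 / ‖p.1 - p.2‖ ^ s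
  have hcswap : ∀ p, c p.swap = c p := fun p => by
    by_cases hp : p ∈ S
    · simp only [c, indicator_of_mem hp, indicator_of_mem ((hSswap p).2 hp), Prod.fst_swap,
        Prod.snd_swap]
      rw [norm_sub_rev]
    · simp only [c, indicator_of_notMem hp, indicator_of_notMem fun h => hp ((hSswap p).1 h)]
  have hint2 : Integrable (fun p => m (holderQuot s u p) * (c p * φ p.2)) (nuMeasure n) := by
    refine (hu.integrable_mul hm (memOrlicz_truncated_kernel (s := s) hn hs0 hs1
      hm.isYoungLike hφm hφ hε)).congr (ae_of_all _ fun p => ?_)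
    by_cases hp : p ∈ S
    · simp only [c, S, indicator_of_mem hp] at hp ⊢
      ring
    · simp only [c, S, indicator_of_notMem hp] at hp ⊢
      ring
  have hswap : ∀ p, m (holderQuot s u p.swap) * (c p.swap * φ p.swap.2) =
      -(m (holderQuot s u p) * (c p * φ p.1)) := fun p => by
    rw [holderQuot_swap, hm.odd, hcswap, Prod.snd_swap]; ring
  have hint1 : Integrable (fun p => m (holderQuot s u p) * (c p * φ p.1)) (nuMeasure n) := by
    have h := (measurePreserving_nu_swap (n := n)).integrable_comp_of_integrable hint2
    refine h.neg.congr (ae_of_all _ fun p => ?_)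
    simp only [Pi.neg_apply, Function.comp_apply, hswap, neg_neg]
  have heq : ∫ p, m (holderQuot s u p) * (c p * φ p.2) ∂(nuMeasure n) =
      - ∫ p, m (holderQuot s u p) * (c p * φ p.1) ∂(nuMeasure n) := by
    rw [← (measurePreserving_nu_swap (n := n)).integral_comp
      (MeasurableEquiv.prodComm (α := Rn n) (β := Rn n)).measurableEmbedding, ← integral_neg]
    exact integral_congr_ae (ae_of_all _ hswap)
  have hrhs : ∫ p, S.indicator (fun p => m (holderQuot s u p) * holderQuot s φ p) p
      ∂(nuMeasure n) = 2 * ∫ p, m (holderQuot s u p) * (c p * φ p.1) ∂(nuMeasure n) := by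
    calc _ = ∫ p, (m (holderQuot s u p) * (c p * φ p.1) - m (holderQuot s u p) * (c p * φ p.2))
          ∂(nuMeasure n) := by
          refine integral_congr_ae (ae_of_all _ fun p => ?_)
          by_cases hp : p ∈ S
          · simp only [c, indicator_of_mem hp, holderQuot]; ring
          · simp only [c, indicator_of_notMem hp]; ring
      _ = _ := by rw [integral_sub hint1 hint2, heq]; ring
  rw [hrhs, integral_nuMeasure, Measure.volume_eq_prod, integral_prod, ← integral_const_mul]
  · refine integral_congr_ae (ae_of_all _ fun x => ?_)
    have hS' : MeasurableSet {y : Rn n | ε ≤ ‖x - y‖} :=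
      measurableSet_le measurable_const (by fun_prop)
    simp only [fracLapTrunc]
    rw [← integral_indicator hS', mul_assoc, ← integral_mul_const]
    congr 1
    refine integral_congr_ae (ae_of_all _ fun y => ?_)
    by_cases hy : ε ≤ ‖x - y‖
    · have h0 : 0 < ‖x - y‖ := hε.trans_le hy
      simp only [c, indicator_of_mem (show y ∈ {y : Rn n | ε ≤ ‖x - y‖} from hy),
        indicator_of_mem (show (x, y) ∈ S from hy)]
      rw [Real.rpow_add h0, Real.rpow_natCast]
      field_simp
    · simp only [c, indicator_of_notMem (show y ∉ {y : Rn n | ε ≤ ‖x - y‖} from hy),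
        indicator_of_notMem (show (x, y) ∉ S from hy)]
      ring
  · exact (integrable_nuMeasure_iff _).1 hint1

/-- The weak form `⟨(-Δ_m)ˢu, φ⟩ = ∬ m(Dˢu) Dˢφ dν`. -/
theorem fracLap_eq_pairing (hn : 0 < n) (hs0 : 0 < s) (hs1 : s < 1) (hm : IsYoungDensity m)
    {u : Rn n → ℝ}
    (hu : MemOrlicz (complementaryFn (youngFn m)) (nuMeasure n) fun p => m (holderQuot s u p))
    (φ : 𝓓(Ω, ℝ)) :
    fracLap m s Ω u φ = pairing s (fun _ => 0) (fun p => m (holderQuot s u p)) φ := by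
  refine Tendsto.limUnder_eq ?_
  have hφ := memWL_test (s := s) hn hs0 hs1 hm.isYoungLike φ
  have hint := hu.integrable_mul hm hφ.2
  have hS : ∀ ε : ℝ, MeasurableSet {p : Rn n × Rn n | ε ≤ ‖p.1 - p.2‖} := fun ε =>
    measurableSet_le measurable_const (measurable_fst.sub measurable_snd).norm
  have hlim : Tendsto (fun ε : ℝ => ∫ p, {p : Rn n × Rn n | ε ≤ ‖p.1 - p.2‖}.indicator
        (fun p => m (holderQuot s u p) * holderQuot s φ p) p ∂(nuMeasure n)) (𝓝[>] 0)
      (𝓝 (∫ p, m (holderQuot s u p) * holderQuot s φ p ∂(nuMeasure n))) := by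
    refine tendsto_integral_filter_of_dominated_convergence
      (fun p => ‖m (holderQuot s u p) * holderQuot s φ p‖)
      (Eventually.of_forall fun ε => hint.1.indicator (hS ε))
      (Eventually.of_forall fun ε => ae_of_all _ fun p => norm_indicator_le_norm_self _ _)
      hint.norm (ae_of_all _ fun p => tendsto_const_nhds.congr' ?_)
    -- Off the diagonal the indicator is eventually 1; on the diagonal `Dˢφ` is 0, so nothing is
    -- lost.
    by_cases hp : p.1 = p.2
    · refine Eventually.of_forall fun ε => ?_
      have : holderQuot s φ p = 0 := by simp [holderQuot, hp]
      by_cases hpj : p ∈ {p : Rn n × Rn n | ε ≤ ‖p.1 - p.2‖}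
      · simp only [indicator_of_mem hpj]
      · simp only [indicator_of_notMem hpj, this, mul_zero]
    · have h1 : 0 < ‖p.1 - p.2‖ := norm_pos_iff.2 (sub_ne_zero.2 hp)
      filter_upwards [Ioo_mem_nhdsGT h1] with ε hε
      rw [indicator_of_mem (show p ∈ {p : Rn n × Rn n | ε ≤ ‖p.1 - p.2‖} from hε.2.le)]
  simp only [pairing, zero_mul, integral_zero, zero_add]
  refine hlim.congr' ?_
  filter_upwards [self_mem_nhdsWithin] with ε hε
  exact (integral_fracLapTrunc hn hs0 hs1 hm hu φ.continuous.measurable hφ.1 hε).symm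

end FracLap

/-! ## Compactness -/

section Compactness

variable {m : ℝ → ℝ} {s : ℝ}

/-- The mean value of `w` over the ball `B_δ(x)`. -/
def ballMean (δ : ℝ) (w : Rn n → ℝ) (x : Rn n) : ℝ :=
  (volume.real (Metric.ball (0 : Rn n) δ))⁻¹ * ∫ y in Metric.ball x δ, w y

theorem measurable_ballMean {δ : ℝ} {w : Rn n → ℝ} (hw : Measurable w) :
    Measurable (ballMean δ w) := by
  have e : ballMean δ w = fun x => (volume.real (Metric.ball (0 : Rn n) δ))⁻¹ *
      ∫ y, {q : Rn n × Rn n | dist q.2 q.1 < δ}.indicator (fun q => w q.2) (x, y) := by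
    ext x
    rw [ballMean, ← integral_indicator measurableSet_ball]
    rfl
  have hm : Measurable ({q : Rn n × Rn n | dist q.2 q.1 < δ}.indicator (fun q => w q.2)) :=
    (hw.comp measurable_snd).indicator (measurableSet_lt (by fun_prop) measurable_const)
  rw [e]
  exact (hm.stronglyMeasurable.integral_prod_right' (ν := volume)).measurable.const_mul _

/-- Here `|w(x) - w(y)| ≤ |Dˢw| δ^s` and `|t| ≤ k (1 + M(t/k)/M(1))`. The factor `(δ/|x - y|)^n ≥ 1`
is inserted to produce the density of `ν_n`. -/
theorem enorm_sub_le_of_norm_lt (hs0 : 0 < s) (hm : IsYoungDensity m) {w : Rn n → ℝ} {k : ℝ}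
    (hk : 0 < k) {δ : ℝ} (hδ : 0 < δ) {x y : Rn n} (hxy : ‖x - y‖ < δ) :
    ‖w x - w y‖ₑ ≤ ENNReal.ofReal (k * δ ^ s) * (1 + ENNReal.ofReal (δ ^ n / youngFn m 1) *
      (ENNReal.ofReal (1 / ‖x - y‖ ^ n) *
        ENNReal.ofReal (youngFn m (holderQuot s w (x, y) / k)))) := by
  rcases eq_or_ne x y with rfl | hne
  · simp
  have hM := hm.isYoungLike
  have h1 := hm.youngFn_pos one_pos
  have h0 : 0 < ‖x - y‖ := norm_pos_iff.2 (sub_ne_zero.2 hne)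
  set t := holderQuot s w (x, y) with ht
  have hMt := hM.nonneg (t / k)
  have e : w x - w y = t * ‖x - y‖ ^ s := by
    rw [ht, holderQuot]
    field_simp
  have h2 := hM.abs_le h1 (t / k)
  rw [abs_div, abs_of_pos hk, div_le_iff₀ hk] at h2
  have h3 : 1 ≤ δ ^ n * (1 / ‖x - y‖ ^ n) := by
    rw [mul_one_div, one_le_div (by positivity)]
    exact pow_le_pow_left₀ h0.le hxy.le n
  have key : |w x - w y| ≤ k * δ ^ s * (1 + δ ^ n / youngFn m 1 * (1 / ‖x - y‖ ^ n *
      youngFn m (t / k))) := by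
    rw [e, abs_mul, abs_of_nonneg (by positivity : 0 ≤ ‖x - y‖ ^ s)]
    calc |t| * ‖x - y‖ ^ s ≤ ((1 + youngFn m (t / k) / youngFn m 1) * k) * δ ^ s := by
          gcongr
      _ = k * δ ^ s * (1 + 1 * (youngFn m (t / k) / youngFn m 1)) := by ring
      _ ≤ k * δ ^ s * (1 + (δ ^ n * (1 / ‖x - y‖ ^ n)) * (youngFn m (t / k) / youngFn m 1)) := by
          gcongr
      _ = _ := by ring
  rw [Real.enorm_eq_ofReal_abs]
  refine (ENNReal.ofReal_le_ofReal key).trans_eq ?_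
  rw [ENNReal.ofReal_mul (by positivity), ENNReal.ofReal_add zero_le_one (by positivity),
    ENNReal.ofReal_one, ENNReal.ofReal_mul (p := δ ^ n / youngFn m 1) (by positivity),
    ENNReal.ofReal_mul (p := 1 / ‖x - y‖ ^ n) (by positivity)]

theorem enorm_sub_ballMean_le (hm : IsYoungDensity m) {w : Rn n → ℝ}
    (hw : MemOrlicz (youngFn m) volume w) {δ : ℝ} (hδ : 0 < δ) (x : Rn n) :
    ‖w x - ballMean δ w x‖ₑ ≤ (volume (Metric.ball (0 : Rn n) δ))⁻¹ *
      ∫⁻ y in Metric.ball x δ, ‖w x - w y‖ₑ := by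
  have hV0 : volume (Metric.ball (0 : Rn n) δ) ≠ 0 := (Metric.measure_ball_pos _ _ hδ).ne'
  have hV1 : volume (Metric.ball (0 : Rn n) δ) ≠ ∞ := measure_ball_lt_top.ne
  have hVx : volume.real (Metric.ball x δ) = volume.real (Metric.ball (0 : Rn n) δ) := by
    simp only [Measure.real, Measure.addHaar_ball_center]
  have hVr : 0 < volume.real (Metric.ball (0 : Rn n) δ) := ENNReal.toReal_pos hV0 hV1
  have hi : IntegrableOn w (Metric.ball x δ) := hw.integrableOn hm measure_ball_lt_top
  have hc : IntegrableOn (fun _ => w x) (Metric.ball x δ) :=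
    integrableOn_const measure_ball_lt_top.ne
  have e : w x - ballMean δ w x = (volume.real (Metric.ball (0 : Rn n) δ))⁻¹ *
      ∫ y in Metric.ball x δ, (w x - w y) := by
    rw [integral_sub hc hi, setIntegral_const, hVx, ballMean, smul_eq_mul, mul_sub,
      inv_mul_cancel_left₀ hVr.ne']
  rw [e, enorm_mul]
  refine mul_le_mul' (le_of_eq ?_) (enorm_integral_le_lintegral_enorm _)
  rw [Real.enorm_eq_ofReal (by positivity), ENNReal.ofReal_inv_of_pos hVr, Measure.real,
    ENNReal.ofReal_toReal hV1]

/-- The deviation of `w` from its means over balls of radius `δ` is of order `δˢ`. -/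
theorem lintegral_sub_ballMean_le (hs0 : 0 < s) (hm : IsYoungDensity m) {w : Rn n → ℝ}
    (hwm : Measurable w) (hw : MemOrlicz (youngFn m) volume w) {k : ℝ} (hk : 0 < k) {δ : ℝ}
    (hδ : 0 < δ) (S : Set (Rn n)) :
    ∫⁻ x in S, ‖w x - ballMean δ w x‖ₑ ≤ ENNReal.ofReal (k * δ ^ s) * (volume S +
      ENNReal.ofReal (1 / youngFn m 1) * (volume (Metric.ball (0 : Rn n) 1))⁻¹ *
        modular (youngFn m) (nuMeasure n) (fun p => holderQuot s w p / k)) := by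
  set V := volume (Metric.ball (0 : Rn n) δ) with hV
  have hV0 : V ≠ 0 := (Metric.measure_ball_pos _ _ hδ).ne'
  have hV1 : V ≠ ∞ := measure_ball_lt_top.ne
  set c := ENNReal.ofReal (k * δ ^ s)
  set a := ENNReal.ofReal (δ ^ n / youngFn m 1)
  set d : Rn n × Rn n → ℝ≥0∞ := fun p => ENNReal.ofReal (1 / ‖p.1 - p.2‖ ^ n) *
    ENNReal.ofReal (youngFn m (holderQuot s w p / k))
  have hd : Measurable d := measurable_nuDensity.mul
    (hm.isYoungLike.measurable.comp ((measurable_holderQuot hwm).div_const k)).ennreal_ofReal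
  have hmod : modular (youngFn m) (nuMeasure n) (fun p => holderQuot s w p / k) =
      ∫⁻ x, ∫⁻ y, d (x, y) := by
    rw [modular, lintegral_nuMeasure, Measure.volume_eq_prod, lintegral_prod _ hd.aemeasurable]
  have hpt : ∀ x, ‖w x - ballMean δ w x‖ₑ ≤ c * (1 + a * V⁻¹ * ∫⁻ y, d (x, y)) := by
    intro x
    refine (enorm_sub_ballMean_le hm hw hδ x).trans ?_
    have h1 : ∫⁻ y in Metric.ball x δ, ‖w x - w y‖ₑ ≤
        ∫⁻ y in Metric.ball x δ, c * (1 + a * d (x, y)) :=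
      setLIntegral_mono' measurableSet_ball fun y hy => by
        refine enorm_sub_le_of_norm_lt hs0 hm hk hδ ?_
        rwa [← dist_eq_norm, dist_comm]
    have hdx : Measurable fun y => d (x, y) := hd.comp (by fun_prop)
    have h2 : ∫⁻ y in Metric.ball x δ, c * (1 + a * d (x, y)) ≤
        c * (V + a * ∫⁻ y, d (x, y)) := by
      rw [lintegral_const_mul _ (by fun_prop), lintegral_add_left measurable_const,
        setLIntegral_const, one_mul, Measure.addHaar_ball_center, lintegral_const_mul _ hdx]
      gcongr
      exact Measure.restrict_le_self
    refine (mul_le_mul_right (h1.trans h2) _).trans_eq ?_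
    rw [← mul_assoc, mul_comm _ c, mul_assoc, mul_add, ENNReal.inv_mul_cancel hV0 hV1,
      ← mul_assoc, mul_comm _ a]
  -- The ball has volume proportional to `δ^n`, which cancels the inserted factor and leaves only
  -- `δ^s`.
  have ha : a * V⁻¹ = ENNReal.ofReal (1 / youngFn m 1) *
      (volume (Metric.ball (0 : Rn n) 1))⁻¹ := by
    have h1 := hm.youngFn_pos one_pos
    have h2 : 0 < δ ^ n := by positivity
    have e : V = ENNReal.ofReal (δ ^ n) * volume (Metric.ball (0 : Rn n) 1) := by
      rw [hV, Measure.addHaar_ball_of_pos _ _ hδ, finrank_euclideanSpace, Fintype.card_fin]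
    have e2 : a = ENNReal.ofReal (1 / youngFn m 1) * ENNReal.ofReal (δ ^ n) := by
      rw [← ENNReal.ofReal_mul (by positivity)]
      simp only [a]; congr 1; ring
    rw [e, e2, ENNReal.mul_inv (Or.inl (by simpa using h2)) (Or.inl ENNReal.ofReal_ne_top),
      mul_assoc, ← mul_assoc (ENNReal.ofReal (δ ^ n)),
      ENNReal.mul_inv_cancel (by simpa using h2) ENNReal.ofReal_ne_top, one_mul]
  rw [← ha, hmod]
  refine (lintegral_mono fun x => hpt x).trans ?_
  have hdi : Measurable fun x => ∫⁻ y, d (x, y) := hd.lintegral_prod_right'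
  rw [lintegral_const_mul _ (by fun_prop), lintegral_add_left measurable_const,
    setLIntegral_const, one_mul, lintegral_const_mul _ hdi]
  gcongr
  exact Measure.restrict_le_self

/-- A sequence with bounded modulars of the Hölder quotients whose means over balls converge,
converges in measure on bounded sets. -/
theorem tendstoInMeasure_of_ballMean (hs0 : 0 < s) (hm : IsYoungDensity m)
    {w : ℕ → Rn n → ℝ} {u : Rn n → ℝ} (hwm : ∀ i, Measurable (w i)) (hum : Measurable u)
    (hw : ∀ i, MemOrlicz (youngFn m) volume (w i)) (hu : MemWL (youngFn m) s u) {C : ℝ≥0∞}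
    (hC : C < ∞) (hwC : ∀ i, modular (youngFn m) (nuMeasure n) (holderQuot s (w i)) ≤ C)
    (hlim : ∀ x, ∀ δ, 0 < δ → Tendsto (fun i => ∫ y in Metric.ball x δ, w i y) atTop
      (𝓝 (∫ y in Metric.ball x δ, u y))) {S : Set (Rn n)} (hS : volume S < ∞) :
    TendstoInMeasure (volume.restrict S) w atTop u := by
  obtain ⟨hu1, -, k, hk, huk⟩ := hu
  set K := ENNReal.ofReal (1 / youngFn m 1) * (volume (Metric.ball (0 : Rn n) 1))⁻¹
  have hK : K < ∞ := ENNReal.mul_lt_top ENNReal.ofReal_lt_top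
    (ENNReal.inv_lt_top.2 (Metric.measure_ball_pos _ _ one_pos))
  set D₁ := volume S + K * C
  set D₂ := volume S + K * modular (youngFn m) (nuMeasure n) (fun p => holderQuot s u p / k)
  have hD₁ : D₁ ≠ ∞ := (ENNReal.add_lt_top.2 ⟨hS, ENNReal.mul_lt_top hK hC⟩).ne
  have hD₂ : D₂ ≠ ∞ := (ENNReal.add_lt_top.2 ⟨hS, ENNReal.mul_lt_top hK huk⟩).ne
  have hb₁ : ∀ i, ∀ δ, 0 < δ → ∫⁻ x in S, ‖w i x - ballMean δ (w i) x‖ₑ ≤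
      ENNReal.ofReal (1 * δ ^ s) * D₁ := fun i δ hδ => by
    refine (lintegral_sub_ballMean_le hs0 hm (hwm i) (hw i) one_pos hδ S).trans ?_
    show _ ≤ ENNReal.ofReal (1 * δ ^ s) * (volume S + K * C)
    simp only [div_one (holderQuot _ _ _)]
    gcongr
    exact hwC i
  have hb₂ : ∀ δ, 0 < δ → ∫⁻ x in S, ‖u x - ballMean δ u x‖ₑ ≤
      ENNReal.ofReal (k * δ ^ s) * D₂ := fun δ hδ =>
    lintegral_sub_ballMean_le hs0 hm hum hu1 hk hδ S
  have hsmall : ∀ (k : ℝ) (D e : ℝ≥0∞), D ≠ ∞ → e ≠ 0 →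
      Tendsto (fun δ : ℝ => ENNReal.ofReal (k * δ ^ s) * D / e) (𝓝[>] 0) (𝓝 0) := by
    intro k D e hD he
    have h1 : Tendsto (fun δ : ℝ => k * δ ^ s) (𝓝 0) (𝓝 (k * 0 ^ s)) :=
      ((Real.continuousAt_rpow_const 0 s (Or.inr hs0.le)).tendsto).const_mul k
    rw [Real.zero_rpow hs0.ne', mul_zero] at h1
    have h2 := (ENNReal.continuous_ofReal.tendsto _).comp (h1.mono_left (nhdsWithin_le_nhds (s := Ioi 0)))
    rw [ENNReal.ofReal_zero] at h2
    have h3 := ENNReal.Tendsto.div_const (ENNReal.Tendsto.mul_const h2 (Or.inr hD))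
      (Or.inr he) (b := e)
    simpa using h3
  have : IsFiniteMeasure (volume.restrict S) := ⟨by simpa using hS⟩
  refine tendstoInMeasure_of_ne_top fun ε hε hε' => ENNReal.tendsto_atTop_zero.2 fun η hη => ?_
  have hε3 : ε / 3 ≠ 0 := (ENNReal.div_pos hε.ne' (by simp)).ne'
  have hε3' : ε / 3 ≠ ∞ := ENNReal.div_ne_top hε' (by simp)
  have hη3 : 0 < η / 3 := ENNReal.div_pos hη.ne' (by simp)
  -- `δ` is fixed first, uniformly in `i`, so that by Markov's inequality both deviations from the
  -- means are small in measure; only then does `i → ∞` in the means themselves.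
  obtain ⟨δ, hδ₁, hδ₂, hδ⟩ := (((hsmall 1 D₁ (ε / 3) hD₁ hε3).eventually_le_const hη3).and
    (((hsmall k D₂ (ε / 3) hD₂ hε3).eventually_le_const hη3).and self_mem_nhdsWithin)).exists
  have hδ : 0 < δ := hδ
  have hmean : TendstoInMeasure (volume.restrict S) (fun i => ballMean δ (w i)) atTop
      (ballMean δ u) :=
    tendstoInMeasure_of_tendsto_ae (fun i => (measurable_ballMean (hwm i)).aestronglyMeasurable)
      (ae_of_all _ fun x => (hlim x δ hδ).const_mul _)
  obtain ⟨N, hN⟩ := ENNReal.tendsto_atTop_zero.1 (hmean (ε / 3) (ENNReal.div_pos hε.ne' (by simp)))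
    (η / 3) hη3
  refine ⟨N, fun i hi => ?_⟩
  have hm₁ := (meas_ge_le_lintegral_div (μ := volume.restrict S)
    (((hwm i).sub (measurable_ballMean (δ := δ) (hwm i))).enorm.aemeasurable) hε3 hε3').trans
    ((ENNReal.div_le_div_right (hb₁ i δ hδ) _).trans hδ₁)
  have hm₂ := (meas_ge_le_lintegral_div (μ := volume.restrict S)
    ((hum.sub (measurable_ballMean (δ := δ) hum)).enorm.aemeasurable) hε3 hε3').trans
    ((ENNReal.div_le_div_right (hb₂ δ hδ) _).trans hδ₂)
  refine le_trans (measure_mono (t := {x | ε / 3 ≤ ‖(w i - ballMean δ (w i)) x‖ₑ} ∪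
    ({x | ε / 3 ≤ edist (ballMean δ (w i) x) (ballMean δ u x)} ∪
      {x | ε / 3 ≤ ‖(u - ballMean δ u) x‖ₑ})) fun x hx => ?_) ?_
  · by_contra hcon
    simp only [mem_union, mem_ofPred_eq, not_or, not_le, Pi.sub_apply] at hcon hx
    obtain ⟨h1, h2, h3⟩ := hcon
    have h4 : edist (w i x) (u x) ≤ edist (w i x) (ballMean δ (w i) x) +
        edist (ballMean δ (w i) x) (ballMean δ u x) + edist (ballMean δ u x) (u x) :=
      edist_triangle4 _ _ _ _
    rw [← edist_eq_enorm_sub] at h1 h3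
    rw [edist_comm] at h3
    have h5 := ENNReal.add_lt_add (ENNReal.add_lt_add h1 h2) h3
    rw [ENNReal.add_thirds] at h5
    exact absurd (hx.trans h4) (not_le.2 h5)
  · refine (measure_union_le _ _).trans ?_
    refine (add_le_add hm₁ ((measure_union_le _ _).trans (add_le_add (hN i hi) hm₂))).trans_eq ?_
    rw [← add_assoc, ENNReal.add_thirds]

end Compactness

/-! ## Passage to the limit -/

section Limit

variable {m : ℝ → ℝ} {s : ℝ} {Ω : Opens (Rn n)}

theorem memOrlicz_zero {X : Type*} [MeasurableSpace X] {μ : Measure X} {A : ℝ → ℝ}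
    (hA : IsYoungLike A) : MemOrlicz A μ fun _ => (0 : ℝ) :=
  memOrlicz_of_modular aemeasurable_const (by simp [modular, hA.zero])

theorem pairing_zero_left (G : Rn n × Rn n → ℝ) (v : Rn n → ℝ) :
    pairing s (fun _ => 0) G v = ∫ p, G p * holderQuot s v p ∂(nuMeasure n) := by
  simp [pairing]

theorem MemDom.memNegL_fracLap (hn : 0 < n) (hs0 : 0 < s) (hs1 : s < 1) (hm : IsYoungDensity m)
    {u : Rn n → ℝ} (hu : MemDom m s Ω u) : MemNegL m s Ω (fracLap m s Ω u) :=
  ⟨_, _, memOrlicz_zero hm.isYoungLike_complementary, hu.2,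
    fracLap_eq_pairing hn hs0 hs1 hm hu.2⟩

theorem MemDom.dualPair_fracLap (hn : 0 < n) (hs0 : 0 < s) (hs1 : s < 1) (hm : IsYoungDensity m)
    (hΩb : Bornology.IsBounded (Ω : Set (Rn n))) (hΩs : SegmentProperty (Ω : Set (Rn n)))
    {u v : Rn n → ℝ} (hu : MemDom m s Ω u) (hv : MemW0L m s Ω v) :
    dualPair m s Ω (fracLap m s Ω u) v =
      ∫ p, m (holderQuot s u p) * holderQuot s v p ∂(nuMeasure n) := by
  rw [dualPair_eq hn hs0 hs1 hm hΩb hΩs (memOrlicz_zero hm.isYoungLike_complementary) hu.2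
    (fracLap_eq_pairing hn hs0 hs1 hm hu.2) hv, pairing_zero_left]

/-- The indicator of a ball belongs to `E_M̅`, so the weak convergence in the first hypothesis
includes convergence of ball means. -/
theorem dualPair_ball (hn : 0 < n) (hs0 : 0 < s) (hs1 : s < 1) (hm : IsYoungDensity m)
    (hΩb : Bornology.IsBounded (Ω : Set (Rn n))) (hΩs : SegmentProperty (Ω : Set (Rn n)))
    (x : Rn n) (δ : ℝ) : ∃ S : 𝓓(Ω, ℝ) → ℝ, MemNegE m s Ω S ∧
      ∀ v, MemW0L m s Ω v → dualPair m s Ω S v = ∫ y in Metric.ball x δ, v y := by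
  have hB := hm.isYoungLike_complementary
  set g : Rn n → ℝ := (Metric.ball x δ).indicator fun _ => 1
  have hg : MemOrliczE (complementaryFn (youngFn m)) volume g := by
    refine memOrliczE_of_bounded hB (measurable_const.indicator measurableSet_ball) (C := 1)
      (fun y => ?_) (Metric.isBounded_ball.subset support_indicator_subset)
      ((measure_mono support_indicator_subset).trans_lt measure_ball_lt_top)
    by_cases hy : y ∈ Metric.ball x δ <;> simp [g, hy]
  refine ⟨fun φ => pairing s g (fun _ => 0) φ, ⟨g, fun _ => 0, hg, memOrliczE_zero hB,
    fun _ => rfl⟩, fun v hv => ?_⟩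
  rw [dualPair_eq hn hs0 hs1 hm hΩb hΩs hg.1 (memOrlicz_zero hB) (fun _ => rfl) hv]
  simp only [pairing, zero_mul, integral_zero, add_zero]
  rw [← integral_indicator measurableSet_ball]
  refine integral_congr_ae (ae_of_all _ fun y => ?_)
  by_cases hy : y ∈ Metric.ball x δ <;> simp [g, hy]

theorem MemDom.integrable (hm : IsYoungDensity m) {u : Rn n → ℝ} (hu : MemDom m s Ω u) :
    Integrable (fun p => m (holderQuot s u p) * holderQuot s u p) (nuMeasure n) :=
  hu.2.integrable_mul hm hu.1.1.2

theorem modular_le_of_integral_le {X : Type*} [MeasurableSpace X] {μ : Measure X} {A : ℝ → ℝ}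
    {h F : X → ℝ} (hF : Integrable F μ) (hle : ∀ x, A (h x) ≤ F x) (h0 : ∀ x, 0 ≤ F x) {C : ℝ}
    (hC : ∫ x, F x ∂μ ≤ C) : modular A μ h ≤ ENNReal.ofReal C := by
  refine (lintegral_mono fun x => ENNReal.ofReal_le_ofReal (hle x)).trans ?_
  rw [← ofReal_integral_eq_lintegral_ofReal hF (ae_of_all _ h0)]
  exact ENNReal.ofReal_le_ofReal hC

/-- Along a subsequence, the Hölder quotients and their images under `m` converge a.e. -/
theorem exists_subseq_ae_tendsto_holderQuot (hn : 0 < n) (hs0 : 0 < s) (hs1 : s < 1)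
    (hm : IsYoungDensity m) (hΩb : Bornology.IsBounded (Ω : Set (Rn n))) {w : ℕ → Rn n → ℝ}
    (hw : ∀ i, MemDom m s Ω (w i)) {u : Rn n → ℝ} (hu : MemW0L m s Ω u) {C : ℝ}
    (hC : ∀ i, ∫ p, m (holderQuot s (w i) p) * holderQuot s (w i) p ∂(nuMeasure n) ≤ C)
    (hlim : ∀ x, ∀ δ, 0 < δ → Tendsto (fun i => ∫ y in Metric.ball x δ, w i y) atTop
      (𝓝 (∫ y in Metric.ball x δ, u y))) :
    ∃ ns : ℕ → ℕ, Tendsto ns atTop atTop ∧ ∀ᵐ p ∂(nuMeasure n),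
      Tendsto (fun j => holderQuot s (w (ns j)) p) atTop (𝓝 (holderQuot s u p)) ∧
      Tendsto (fun j => m (holderQuot s (w (ns j)) p)) atTop (𝓝 (m (holderQuot s u p))) := by
  have hwa := fun i => (hw i).1.1.1.1.ae_eq_mk
  have hua := hu.1.1.1.ae_eq_mk
  set w' : ℕ → Rn n → ℝ := fun i => (hw i).1.1.1.1.mk (w i)
  set u' := hu.1.1.1.mk u
  have hwm : ∀ i, Measurable (w' i) := fun i => (hw i).1.1.1.1.measurable_mk
  have hum : Measurable u' := hu.1.1.1.measurable_mk
  have hwW : ∀ i, MemWL (youngFn m) s (w' i) := fun i => (hw i).1.1.congr (hwa i).symm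
  have huW : MemWL (youngFn m) s u' := hu.1.congr hua.symm
  obtain ⟨R, hR⟩ := hΩb.subset_ball 0
  have hmod : ∀ i, modular (youngFn m) (nuMeasure n) (holderQuot s (w' i)) ≤
      ENNReal.ofReal C := fun i => by
    have h := modular_le_of_integral_le ((hw i).integrable hm)
      (fun p => hm.youngFn_le (holderQuot s (w i) p)) (fun p => hm.mul_self_nonneg _) (hC i)
    refine le_trans (modular_mono hm.isYoungLike ?_) h
    filter_upwards [holderQuot_ae_congr (s := s) (hwa i)] with p hp
    rw [hp]
  have hlim' : ∀ x, ∀ δ, 0 < δ → Tendsto (fun i => ∫ y in Metric.ball x δ, w' i y) atTop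
      (𝓝 (∫ y in Metric.ball x δ, u' y)) := fun x δ hδ => by
    have h := hlim x δ hδ
    rw [integral_congr_ae (ae_restrict_of_ae hua)] at h
    exact h.congr fun i => integral_congr_ae (ae_restrict_of_ae (hwa i))
  have hmeas := tendstoInMeasure_of_ballMean hs0 hm hwm hum (fun i => (hwW i).1) huW
    ENNReal.ofReal_lt_top hmod hlim' (S := Metric.ball (0 : Rn n) R) measure_ball_lt_top
  obtain ⟨ns, hns, hae⟩ := hmeas.exists_seq_tendsto_ae
  refine ⟨ns, hns.tendsto_atTop, ?_⟩
  rw [ae_restrict_iff' measurableSet_ball] at hae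
  -- Convergence is needed only on a ball containing `Ω`, since all the functions vanish a.e.
  -- outside `Ω`.
  have hconv : ∀ᵐ x, Tendsto (fun j => w (ns j) x) atTop (𝓝 (u x)) := by
    filter_upwards [hae, ae_all_iff.2 hwa, hua, ae_all_iff.2 fun i => (hw i).1.ae_eq_zero hm,
      hu.ae_eq_zero hm] with x h1 h2 h3 h4 h5
    by_cases hx : x ∈ Ω
    · rw [h3]
      exact (h1 (hR hx)).congr fun j => (h2 _).symm
    · rw [h5 hx]
      exact tendsto_const_nhds.congr fun j => (h4 _ hx).symm
  filter_upwards [ae_nu_of_ae hconv, ae_continuousAt_holderQuot hn hs0 hs1 hm hum,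
    holderQuot_ae_congr (s := s) hua] with p hp hcont hpu
  have h1 : Tendsto (fun j => holderQuot s (w (ns j)) p) atTop (𝓝 (holderQuot s u p)) :=
    (hp.1.sub hp.2).div_const _
  rw [← hpu] at hcont
  exact ⟨h1, hcont.tendsto.comp h1⟩

theorem integrable_youngFn_holderQuot_test (hn : 0 < n) (hs0 : 0 < s) (hs1 : s < 1) (hm : IsYoungDensity m)
    (φ : 𝓓(Ω, ℝ)) (k : ℝ) :
    Integrable (fun p => youngFn m (holderQuot s φ p / k)) (nuMeasure n) := by
  obtain ⟨L, hL, hB, -⟩ := exists_lipschitz_of_contDiff (contDiff_one_test φ) φ.hasCompactSupport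
  refine ⟨(hm.isYoungLike.measurable.comp ((measurable_holderQuot
    φ.continuous.measurable).div_const k)).aestronglyMeasurable, ?_⟩
  rw [hasFiniteIntegral_iff_ofReal (ae_of_all _ fun p => hm.isYoungLike.nonneg _)]
  exact modular_holderQuot_lt_top hn hs0 hs1 hm.isYoungLike hL hB φ.hasCompactSupport k

/-- Weak convergence of `m(F_j)` against `P` with `∫ M(P/ε) < ∞` for all `ε`, from a.e.
convergence and boundedness of `∫ m(F_j) F_j`. -/
theorem integral_mul_le_of_ae_tendsto {X : Type*} [MeasurableSpace X] {μ : Measure X}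
    (hm : IsYoungDensity m) {F : ℕ → X → ℝ} {f P : X → ℝ}
    (hF : ∀ j, Integrable (fun x => m (F j x) * F j x) μ)
    (hFP : ∀ j, Integrable (fun x => m (F j x) * P x) μ)
    (hf : Integrable (fun x => m (f x) * f x) μ) (hfP : Integrable (fun x => m (f x) * P x) μ)
    (hP : ∀ ε : ℝ, Integrable (fun x => youngFn m (P x / ε)) μ)
    (hlim : ∀ᵐ x ∂μ, Tendsto (fun j => F j x) atTop (𝓝 (f x)) ∧
      Tendsto (fun j => m (F j x)) atTop (𝓝 (m (f x)))) {C T : ℝ}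
    (hC : ∀ j, ∫ x, m (F j x) * F j x ∂μ ≤ C)
    (hT : Tendsto (fun j => ∫ x, m (F j x) * P x ∂μ) atTop (𝓝 T)) :
    ∫ x, m (f x) * P x ∂μ ≤ T := by
  have hC0 : 0 ≤ C := (integral_nonneg fun x => hm.mul_self_nonneg _).trans (hC 0)
  refine le_of_forall_pos_le_add fun e he => ?_
  set ε := e / (1 + C)
  have hε : 0 < ε := by positivity
  have hi : ∀ {g : X → ℝ}, Integrable (fun x => m (g x) * g x) μ →
      Integrable (fun x => m (g x) * P x) μ →
      ∫ x, (m (g x) * P x + ε * (m (g x) * g x + youngFn m (P x / ε))) ∂μ =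
      ∫ x, m (g x) * P x ∂μ + ε * (∫ x, m (g x) * g x ∂μ + ∫ x, youngFn m (P x / ε) ∂μ) := by
    intro g h1 h2
    have h3 : Integrable (fun x => ε * (m (g x) * g x + youngFn m (P x / ε))) μ :=
      (h1.add (hP ε)).const_mul _
    rw [integral_add h2 h3, integral_const_mul, integral_add h1 (hP ε)]
  -- The term `ε ∫ M(P/ε)`, which need not be small as `ε → 0`, occurs on both sides and cancels.
  -- What remains is an error `ε (1 + C) = e`.
  have h := integral_le_of_tendsto_ae
    (F := fun j x => m (F j x) * P x + ε * (m (F j x) * F j x + youngFn m (P x / ε)))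
    (f := fun x => m (f x) * P x + ε * (m (f x) * f x + youngFn m (P x / ε))) (μ := μ)
    (C := T + ε + ε * (C + ∫ x, youngFn m (P x / ε) ∂μ))
    (fun j => (hFP j).add (((hF j).add (hP ε)).const_mul _))
    (fun j => ae_of_all _ fun x => ?_) (hlim.mono fun x hx => ?_) ?_
  · have h2 := h.2
    rw [hi hf hfP] at h2
    have h3 : 0 ≤ ε * ∫ x, m (f x) * f x ∂μ :=
      mul_nonneg hε.le (integral_nonneg fun x => hm.mul_self_nonneg _)
    have h4 : ε * (1 + C) = e := div_mul_cancel₀ _ (by positivity)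
    nlinarith
  · have h1 := hm.young (m (F j x)) (P x / ε)
    have h2 := hm.complementaryFn_map_le (F j x)
    have h3 : m (F j x) * P x = ε * (m (F j x) * (P x / ε)) := by field_simp
    have h4 := neg_abs_le (m (F j x) * (P x / ε))
    rw [h3, ← mul_add]
    refine mul_nonneg hε.le ?_
    linarith
  · exact (hx.2.mul_const _).add (((hx.2.mul hx.1).add_const _).const_mul _)
  · refine Eventually.frequently ?_
    filter_upwards [hT.eventually_le_const (by linarith : T < T + ε)] with j hj
    rw [hi (hF j) (hFP j)]
    have := hC j
    gcongr

end Limit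

end

/-! ### The convergence theorem -/

theorem theorem3p2 {n : ℕ} (hn : 0 < n) (s : ℝ) (hs0 : 0 < s) (hs1 : s < 1)
    (m : ℝ → ℝ) (hm : IsYoungDensity m)
    (Ω : Opens (Rn n)) (hΩb : Bornology.IsBounded (Ω : Set (Rn n)))
    (hΩs : SegmentProperty (Ω : Set (Rn n)))
    (w : ℕ → Rn n → ℝ) (hw : ∀ i, MemDom m s Ω (w i))
    (u : Rn n → ℝ) (hu : MemW0L m s Ω u)
    (f : 𝓓(Ω, ℝ) → ℝ) (hf : MemNegL m s Ω f)
    (hwu : ∀ S : 𝓓(Ω, ℝ) → ℝ, MemNegE m s Ω S →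
      Tendsto (fun i => dualPair m s Ω S (w i)) atTop (𝓝 (dualPair m s Ω S u)))
    (hwf : ∀ v : Rn n → ℝ, MemW0E m s Ω v →
      Tendsto (fun i => dualPair m s Ω (fracLap m s Ω (w i)) v) atTop (𝓝 (dualPair m s Ω f v)))
    (hsup : limsup (fun i => ((dualPair m s Ω (fracLap m s Ω (w i)) (w i) : ℝ) : EReal)) atTop
      ≤ ((dualPair m s Ω f u : ℝ) : EReal)) :
    MemDom m s Ω u ∧ fracLap m s Ω u = f ∧
      Tendsto (fun i => dualPair m s Ω (fracLap m s Ω (w i)) (w i)) atTop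
        (𝓝 (dualPair m s Ω f u)) := by
  have hB := hm.isYoungLike_complementary
  set a : ℕ → ℝ := fun i => dualPair m s Ω (fracLap m s Ω (w i)) (w i)
  set L := dualPair m s Ω f u with hL
  have ha : ∀ i, a i = ∫ p, m (holderQuot s (w i) p) * holderQuot s (w i) p ∂(nuMeasure n) :=
    fun i => (hw i).dualPair_fracLap hn hs0 hs1 hm hΩb hΩs (hw i).1
  -- Taking the `limsup` in `EReal` yields eventual upper bounds without assuming that the energies
  -- are bounded.
  have hupper : ∀ c, L < c → ∀ᶠ i in atTop, a i < c := fun c hc =>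
    (eventually_lt_of_limsup_lt (hsup.trans_lt (EReal.coe_lt_coe_iff.2 hc))).mono
      fun i hi => EReal.coe_lt_coe_iff.1 hi
  have hball : ∀ x, ∀ δ, 0 < δ → Tendsto (fun i => ∫ y in Metric.ball x δ, w i y) atTop
      (𝓝 (∫ y in Metric.ball x δ, u y)) := by
    intro x δ _
    obtain ⟨S, hS, hSv⟩ := dualPair_ball (Ω := Ω) hn hs0 hs1 hm hΩb hΩs x δ
    rw [← hSv u hu]
    exact (hwu S hS).congr fun i => hSv _ (hw i).1
  obtain ⟨N, hN⟩ := eventually_atTop.1 (hupper (L + 1) (by linarith))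
  have hsub : ∀ θ : ℕ → ℕ, Tendsto θ atTop atTop → ∃ ns : ℕ → ℕ, Tendsto ns atTop atTop ∧
      (∀ j, N ≤ θ (ns j)) ∧ ∀ᵐ p ∂(nuMeasure n),
      Tendsto (fun j => holderQuot s (w (θ (ns j))) p) atTop (𝓝 (holderQuot s u p)) ∧
      Tendsto (fun j => m (holderQuot s (w (θ (ns j))) p)) atTop (𝓝 (m (holderQuot s u p))) := by
    intro θ hθ
    -- The shift by `N'` makes the energy bound `L + 1` hold for every index, as the compactness
    -- lemma requires.
    obtain ⟨N', hN'⟩ := eventually_atTop.1 (hθ.eventually_ge_atTop N)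
    have hθ' : Tendsto (fun j => θ (j + N')) atTop atTop :=
      hθ.comp (tendsto_add_atTop_nat N')
    obtain ⟨ns, hns, h⟩ := exists_subseq_ae_tendsto_holderQuot (w := fun j => w (θ (j + N')))
      (C := L + 1) hn hs0 hs1 hm hΩb (fun j => hw _) hu
      (fun j => (ha _).symm.trans_le (hN _ (hN' _ (by omega))).le)
      (fun x δ hδ => (hball x δ hδ).comp hθ')
    exact ⟨fun j => ns j + N', (tendsto_add_atTop_nat N').comp hns,
      fun j => hN' _ (Nat.le_add_left _ _), h⟩
  have hfatou : ∀ θ : ℕ → ℕ, Tendsto θ atTop atTop → ∀ c, (∀ j, a (θ j) ≤ c) →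
      Integrable (fun p => m (holderQuot s u p) * holderQuot s u p) (nuMeasure n) ∧
      ∫ p, m (holderQuot s u p) * holderQuot s u p ∂(nuMeasure n) ≤ c := by
    intro θ hθ c hc
    obtain ⟨ns, -, -, hae⟩ := hsub θ hθ
    exact integral_le_of_tendsto_ae (fun j => (hw (θ (ns j))).integrable hm)
      (fun j => ae_of_all _ fun p => hm.mul_self_nonneg _)
      (hae.mono fun p hp => hp.2.mul hp.1)
      (Frequently.of_forall fun j => (ha _).symm.trans_le (hc (ns j)))
  obtain ⟨hint, -⟩ := hfatou (fun j => j + N) (tendsto_add_atTop_nat N) (L + 1)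
    fun j => (hN _ (by omega)).le
  have hmu : MemOrlicz (complementaryFn (youngFn m)) (nuMeasure n)
      fun p => m (holderQuot s u p) := by
    refine memOrlicz_of_modular (hm.measurable.comp_aemeasurable hu.1.2.1) ?_
    exact (modular_le_of_integral_le hint (fun p => hm.complementaryFn_map_le _)
      (fun p => hm.mul_self_nonneg _) le_rfl).trans_lt ENNReal.ofReal_lt_top
  have hdom : MemDom m s Ω u := ⟨hu, hmu⟩
  have hfφ : ∀ φ : 𝓓(Ω, ℝ), ∫ p, m (holderQuot s u p) * holderQuot s φ p ∂(nuMeasure n) = f φ := by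
    intro φ
    obtain ⟨ns, hns, hnsN, hae⟩ := hsub id tendsto_id
    simp only [id] at hae hnsN
    have hφ := memWL_test (s := s) hn hs0 hs1 hm.isYoungLike φ
    have hlim : Tendsto (fun i => ∫ p, m (holderQuot s (w i) p) * holderQuot s φ p ∂(nuMeasure n))
        atTop (𝓝 (f φ)) := by
      have h := hwf φ (memW0E_test hn hs0 hs1 hm φ)
      rw [dualPair_test hf] at h
      refine h.congr fun i => ?_
      rw [dualPair_test ((hw i).memNegL_fracLap hn hs0 hs1 hm),
        fracLap_eq_pairing hn hs0 hs1 hm (hw i).2, pairing_zero_left]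
    have hlim' := hlim.comp hns
    have hP := integrable_youngFn_holderQuot_test (s := s) hn hs0 hs1 hm φ
    have hi : ∀ j, Integrable (fun p => m (holderQuot s (w (ns j)) p) * holderQuot s φ p)
        (nuMeasure n) := fun j => (hw (ns j)).2.integrable_mul hm hφ.2
    have hi' := hmu.integrable_mul hm hφ.2
    have hC : ∀ j, ∫ p, m (holderQuot s (w (ns j)) p) * holderQuot s (w (ns j)) p
        ∂(nuMeasure n) ≤ L + 1 := fun j => (ha _).symm.trans_le (hN _ (hnsN j)).le
    refine le_antisymm (integral_mul_le_of_ae_tendsto hm (fun j => (hw (ns j)).integrable hm) hi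
      hint hi' hP hae hC hlim') ?_
    -- The inequality for `-Dˢφ` gives the reverse bound; its modulars are those of `Dˢφ` with `ε`
    -- replaced by `-ε`.
    have h := integral_mul_le_of_ae_tendsto (P := fun p => -holderQuot s φ p) (T := -f φ) hm
      (fun j => (hw (ns j)).integrable hm) (fun j => by simpa using (hi j).neg)
      hint (by simpa using hi'.neg)
      (fun ε => by simpa [neg_div, div_neg] using hP (-ε)) hae hC
      (by simpa [integral_neg] using hlim'.neg)
    simp only [mul_neg, integral_neg] at h
    linarith
  have hfrac : fracLap m s Ω u = f := funext fun φ => by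
    rw [fracLap_eq_pairing hn hs0 hs1 hm hmu, pairing_zero_left, hfφ]
  have hLu : L = ∫ p, m (holderQuot s u p) * holderQuot s u p ∂(nuMeasure n) := by
    rw [hL, ← hfrac, hdom.dualPair_fracLap hn hs0 hs1 hm hΩb hΩs hu]
  refine ⟨hdom, hfrac, tendsto_order.2 ⟨fun c hc => ?_, hupper⟩⟩
  -- Otherwise a subsequence of energies stays at most `c < L`, and Fatou's lemma along it bounds
  -- the energy of `u`, which equals `L`, by `c`.
  by_contra hcon
  obtain ⟨θ, hθ, hθc⟩ := extraction_of_frequently_atTop (not_eventually.1 hcon)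
  have h := (hfatou θ hθ.tendsto_atTop c fun j => not_lt.1 (hθc j)).2
  rw [← hLu] at h
  exact absurd hc (not_lt.2 h)
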